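/- Let $n$ and $k$ be integers with $1\le k<n/2$. Call a function $c:\mathbb R^n\to\mathbb R$ *double bounded* if there is a constant $C>0$ with $1/C\le c(x)\le C$ for all $x\in\mathbb R^n$. By a positive solution we mean a classical one: everywhere positive functions of class $C^{2k}(\mathbb R^n)$ satisfying the equations pointwise on $\mathbb R^n$. (1) Let $p>1$. The equation $$(-\Delta)^k u(x)=c(x)\,u(x)^p,\qquad x\in\mathbb R^n,$$ has a positive solution $u$ for some double bounded function $c$ if and only if $p>\dfrac{n}{n-2k}$. (2) Let $p,q>0$ with $pq>1$. The system $$(-\Delta)^k u(x)=c_1(x)\,v(x)^q,\qquad (-\Delta)^k v(x)=c_2(x)\,u(x)^p,\qquad x\in\mathbb R^n,$$ has a pair of positive solutions $(u,v)$ for some double bounded functions $c_1,c_2$ if and only if $$\max\left\{\frac{2k(p+1)}{pq-1},\ \frac{2k(q+1)}{pq-1}\right\}<n-2k .$$ -/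

import Mathlib

/-- A real function `c` is double bounded if `1 / C ≤ c ≤ C` for some constant `C > 0`. -/
def DoubleBounded {X : Type*} (c : X → ℝ) : Prop :=
  ∃ C : ℝ, 0 < C ∧ ∀ x, 1 / C ≤ c x ∧ c x ≤ C

/-- The polyharmonic operator `(-Δ)^k`: the `k`-fold iterate of `f ↦ -Δ f`. -/
noncomputable def negLaplacianPow {n : ℕ} (k : ℕ) (f : EuclideanSpace ℝ (Fin n) → ℝ) :
    EuclideanSpace ℝ (Fin n) → ℝ :=
  (fun (g : EuclideanSpace ℝ (Fin n) → ℝ) (x : EuclideanSpace ℝ (Fin n)) =>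
    -(Laplacian.laplacian g : EuclideanSpace ℝ (Fin n) → ℝ) x)^[k] f

/-- `u` is a positive classical solution on the whole space of `(-Δ)^k u = c(x) u^p`. -/
structure IsPositiveSolution {n : ℕ} (k : ℕ) (p : ℝ) (c u : EuclideanSpace ℝ (Fin n) → ℝ) :
    Prop where
  contDiff : ContDiff ℝ ((2 * k : ℕ) : WithTop ℕ∞) u
  pos : ∀ x, 0 < u x
  eq : ∀ x, negLaplacianPow k u x = c x * u x ^ p

/-- `(u, v)` is a pair of positive classical solutions on the whole space of the system
`(-Δ)^k u = c₁(x) v^q`, `(-Δ)^k v = c₂(x) u^p`. -/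
structure IsPositiveSystemSolution {n : ℕ} (k : ℕ) (p q : ℝ)
    (c₁ c₂ u v : EuclideanSpace ℝ (Fin n) → ℝ) : Prop where
  contDiff_fst : ContDiff ℝ ((2 * k : ℕ) : WithTop ℕ∞) u
  contDiff_snd : ContDiff ℝ ((2 * k : ℕ) : WithTop ℕ∞) v
  pos_fst : ∀ x, 0 < u x
  pos_snd : ∀ x, 0 < v x
  eq_fst : ∀ x, negLaplacianPow k u x = c₁ x * v x ^ q
  eq_snd : ∀ x, negLaplacianPow k v x = c₂ x * u x ^ p

open Set Filter Topology MeasureTheory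

/-! Put `α = 2k(q+1)/(pq-1)` and `β = 2k(p+1)/(pq-1)`. These solve `α + 2k = βq`, `β + 2k = αp`, so
replacing `(u, v)` by `r^α u(x + r·)`, `r^β v(x + r·)` preserves the class of solutions. The claim
is that solvability means `α, β < n - 2k`, the decay rate of the fundamental solution. The scalar
equation is the case `u = v`, `p = q`.

Existence: take `u = (1+|x|²)^(-α/2)`, `v = (1+|x|²)^(-β/2)`. An explicit formula
(`iterate_radialOp_rpow`) writes `(-Δ)^k u` as a sum of powers with positive coefficients when `α <
n - 2k`, so it is comparable to its leading term `(1+|x|²)^(-α/2-k) = v^q`; the quotients are the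
double bounded coefficients.

Nonexistence concerns supersolutions, and uses only `w ≥ 0` and `(-Δ)^k w ≥ 0`, with no sign for
intermediate powers of the Laplacian. A cutoff bounds the mass of `(-Δ)^k w` in a ball by the mass
of `w` in an annulus. A truncated regularised fundamental solution bounds `w` pointwise by a local
Riesz potential of `(-Δ)^k w` plus local mass. Together they forbid concentration on small sets
(`exists_setIntegral_le_of_volume_lt`), hence a reverse Hölder inequality with a small error, valid
for every exponent `q > 0`. Coupling the two equations, taking suprema over rescaled balls and using
`pq > 1` gives a universal bound for the mass on the unit ball (`exists_setIntegral_fst_bound`).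

In `not_isSupersolution`, scaling then gives `∫_{B_R} v^q ≤ C R^(n-βq)`, where `n - βq = n - 2k -
α`. A negative exponent forces `v^q = 0`. If it is zero, `v^q` is integrable; its small tail makes
the rescaled mass of `u` in a distant annulus small, and the cutoff estimate makes `∫_{B_1} v^q`
smaller than itself. -/

abbrev Euc (n : ℕ) := EuclideanSpace ℝ (Fin n)

/-! ### The iterated operator: regularity, Green's identity, scaling -/

lemma negLaplacianPow_zero {n : ℕ} (f : Euc n → ℝ) : negLaplacianPow 0 f = f := rfl

lemma negLaplacianPow_succ {n : ℕ} (k : ℕ) (f : Euc n → ℝ) :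
    negLaplacianPow (k + 1) f = negLaplacianPow k (negLaplacianPow 1 f) := rfl

lemma negLaplacianPow_succ' {n : ℕ} (k : ℕ) (f : Euc n → ℝ) :
    negLaplacianPow (k + 1) f = negLaplacianPow 1 (negLaplacianPow k f) :=
  Function.iterate_succ_apply' _ _ _

lemma negLaplacianPow_one_apply {n : ℕ} (f : Euc n → ℝ) (x : Euc n) :
    negLaplacianPow 1 f x = -∑ i, fderiv ℝ (fderiv ℝ f) x (EuclideanSpace.basisFun (Fin n) ℝ i)
      (EuclideanSpace.basisFun (Fin n) ℝ i) := by
  change -(Laplacian.laplacian f : Euc n → ℝ) x = _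
  rw [InnerProductSpace.laplacian_eq_iteratedFDeriv_orthonormalBasis f
    (EuclideanSpace.basisFun (Fin n) ℝ)]
  simp [iteratedFDeriv_two_apply]

lemma contDiff_negLaplacianPow_one {n : ℕ} {m : WithTop ℕ∞} {f : Euc n → ℝ}
    (hf : ContDiff ℝ (m + 2) f) : ContDiff ℝ m (negLaplacianPow 1 f) := by
  have : negLaplacianPow 1 f = fun x => -∑ i, fderiv ℝ (fderiv ℝ f) x
      (EuclideanSpace.basisFun (Fin n) ℝ i) (EuclideanSpace.basisFun (Fin n) ℝ i) :=
    funext (negLaplacianPow_one_apply f)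
  rw [this]
  have h1 : ContDiff ℝ (m + 1) (fderiv ℝ f) :=
    hf.fderiv_right (by rw [add_assoc, one_add_one_eq_two])
  have h2 : ContDiff ℝ m (fderiv ℝ (fderiv ℝ f)) := h1.fderiv_right le_rfl
  refine (ContDiff.sum fun i _ => ?_).neg
  exact (h2.clm_apply contDiff_const).clm_apply contDiff_const

lemma contDiff_negLaplacianPow {n : ℕ} (k m : ℕ) {f : Euc n → ℝ}
    (hf : ContDiff ℝ ((2 * k + m : ℕ) : WithTop ℕ∞) f) :
    ContDiff ℝ (m : WithTop ℕ∞) (negLaplacianPow k f) := by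
  induction k generalizing f with
  | zero => simpa [negLaplacianPow_zero] using hf
  | succ k ih =>
    rw [negLaplacianPow_succ]
    refine ih (contDiff_negLaplacianPow_one ?_)
    convert hf using 1
    push_cast
    ring

lemma contDiff_infty_negLaplacianPow {n : ℕ} (k : ℕ) {f : Euc n → ℝ}
    (hf : ContDiff ℝ (⊤ : ℕ∞) f) : ContDiff ℝ (⊤ : ℕ∞) (negLaplacianPow k f) := by
  rw [contDiff_infty] at hf ⊢
  exact fun m => contDiff_negLaplacianPow k m (hf _)

lemma HasCompactSupport.negLaplacianPow {n : ℕ} (k : ℕ) {f : Euc n → ℝ}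
    (hf : HasCompactSupport f) : HasCompactSupport (negLaplacianPow k f) := by
  induction k generalizing f with
  | zero => exact hf
  | succ k ih =>
    rw [negLaplacianPow_succ]
    refine ih ((hf.fderiv ℝ).fderiv ℝ |>.mono fun x hx => ?_)
    rw [Function.mem_support] at hx ⊢
    contrapose! hx
    simp [negLaplacianPow_one_apply, hx]

/-- Two integrations by parts along each basis vector; compact support of `ψ` makes every product
integrable, so `w` may grow arbitrarily. -/
lemma integral_mul_negLaplacianPow_one {n : ℕ} {w ψ : Euc n → ℝ} (hw : ContDiff ℝ 2 w)
    (hψ : ContDiff ℝ 2 ψ) (hc : HasCompactSupport ψ) :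
    ∫ x, w x * negLaplacianPow 1 ψ x = ∫ x, negLaplacianPow 1 w x * ψ x := by
  have hw1 : ContDiff ℝ 1 (fderiv ℝ w) := hw.fderiv_right (by norm_num)
  have hψ1 : ContDiff ℝ 1 (fderiv ℝ ψ) := hψ.fderiv_right (by norm_num)
  have hw2 : Continuous (fderiv ℝ (fderiv ℝ w)) := hw1.continuous_fderiv (by norm_num)
  have hψ2 : Continuous (fderiv ℝ (fderiv ℝ ψ)) := hψ1.continuous_fderiv (by norm_num)
  have hc1 := hc.fderiv ℝ
  have hc2 := hc1.fderiv ℝ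
  have key : ∀ v : Euc n, ∫ x, w x * fderiv ℝ (fderiv ℝ ψ) x v v =
      ∫ x, fderiv ℝ (fderiv ℝ w) x v v * ψ x := by
    intro v
    have aux : ∀ f : Euc n → ℝ, ContDiff ℝ 2 f →
        fderiv ℝ (fun x => fderiv ℝ f x v) = fun x => (fderiv ℝ (fderiv ℝ f) x).flip v := by
      intro f hf
      have hf1 : ContDiff ℝ 1 (fderiv ℝ f) := hf.fderiv_right (by norm_num)
      funext x
      rw [fderiv_clm_apply (hf1.differentiable (by norm_num) x) (by fun_prop)]
      simp
    have cs1 : HasCompactSupport fun x => fderiv ℝ ψ x v :=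
      hc1.comp_left (g := fun L : Euc n →L[ℝ] ℝ => L v) (by simp)
    have cs2 : HasCompactSupport fun x => fderiv ℝ (fderiv ℝ ψ) x v v :=
      hc2.comp_left (g := fun L : Euc n →L[ℝ] Euc n →L[ℝ] ℝ => L v v) (by simp)
    have d1 : Continuous fun x => fderiv ℝ w x v := hw1.continuous.clm_apply continuous_const
    have d2 : Continuous fun x => fderiv ℝ ψ x v := hψ1.continuous.clm_apply continuous_const
    have d3 : Continuous fun x => fderiv ℝ (fderiv ℝ w) x v v :=
      (hw2.clm_apply continuous_const).clm_apply continuous_const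
    have d4 : Continuous fun x => fderiv ℝ (fderiv ℝ ψ) x v v :=
      (hψ2.clm_apply continuous_const).clm_apply continuous_const
    have e1 := integral_mul_fderiv_eq_neg_fderiv_mul_of_integrable (μ := volume) (f := w)
      (g := fun x => fderiv ℝ ψ x v) (v := v)
      ((d1.mul d2).integrable_of_hasCompactSupport cs1.mul_left)
      (by
        simp only [aux ψ hψ]
        exact (hw.continuous.mul d4).integrable_of_hasCompactSupport cs2.mul_left)
      ((hw.continuous.mul d2).integrable_of_hasCompactSupport cs1.mul_left)
      (fun x _ => hw.differentiable (by norm_num) x)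
      (fun x _ => ((hψ1.clm_apply contDiff_const).differentiable (by norm_num)) x)
    have e2 := integral_mul_fderiv_eq_neg_fderiv_mul_of_integrable (μ := volume)
      (f := fun x => fderiv ℝ w x v) (g := ψ) (v := v)
      (by
        simp only [aux w hw]
        exact (d3.mul hψ.continuous).integrable_of_hasCompactSupport hc.mul_left)
      ((d1.mul d2).integrable_of_hasCompactSupport cs1.mul_left)
      ((d1.mul hψ.continuous).integrable_of_hasCompactSupport hc.mul_left)
      (fun x _ => ((hw1.clm_apply contDiff_const).differentiable (by norm_num)) x)
      (fun x _ => hψ.differentiable (by norm_num) x)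
    simp only [aux ψ hψ, aux w hw, ContinuousLinearMap.flip_apply] at e1 e2
    rw [e1, e2, neg_neg]
  simp only [negLaplacianPow_one_apply, mul_neg, neg_mul, Finset.mul_sum, Finset.sum_mul]
  rw [integral_neg, integral_neg, integral_finsetSum, integral_finsetSum]
  · exact congrArg _ (Finset.sum_congr rfl fun i _ => key _)
  · intro i _
    exact (((hw2.clm_apply continuous_const).clm_apply continuous_const).mul
      hψ.continuous).integrable_of_hasCompactSupport hc.mul_left
  · intro i _
    exact (hw.continuous.mul ((hψ2.clm_apply continuous_const).clm_apply
      continuous_const)).integrable_of_hasCompactSupport (HasCompactSupport.mul_left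
      (hc2.comp_left (g := fun L : Euc n →L[ℝ] Euc n →L[ℝ] ℝ => L _ _) (by simp)))

/-- Green's identity for `(-Δ)^k` against a compactly supported test function. -/
theorem integral_mul_negLaplacianPow {n : ℕ} (k : ℕ) {w ψ : Euc n → ℝ}
    (hw : ContDiff ℝ ((2 * k : ℕ) : WithTop ℕ∞) w)
    (hψ : ContDiff ℝ (⊤ : ℕ∞) ψ) (hc : HasCompactSupport ψ) :
    ∫ x, w x * negLaplacianPow k ψ x = ∫ x, negLaplacianPow k w x * ψ x := by
  induction k generalizing ψ with
  | zero => rfl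
  | succ k ih =>
    rw [negLaplacianPow_succ k ψ, negLaplacianPow_succ' k w, ih (hw.of_le (by exact_mod_cast by omega))
      (contDiff_infty_negLaplacianPow 1 hψ) (hc.negLaplacianPow 1)]
    exact integral_mul_negLaplacianPow_one
      (contDiff_negLaplacianPow k 2 hw)
      (contDiff_infty.1 hψ 2) hc

/-- `(-Δ)^k` under an affine change of variables. -/
theorem negLaplacianPow_comp_affine {n : ℕ} (k : ℕ) (w : Euc n → ℝ)
    (hw : ContDiff ℝ ((2 * k : ℕ) : WithTop ℕ∞) w) (c r : ℝ) (x y : Euc n) :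
    negLaplacianPow k (fun z => c * w (x + r • z)) y =
      c * r ^ (2 * k) * negLaplacianPow k w (x + r • y) := by
  induction k generalizing w c with
  | zero => simp [negLaplacianPow_zero]
  | succ k ih =>
    have h2 : ContDiff ℝ 2 w := hw.of_le (by exact_mod_cast by omega)
    have h1 : ContDiff ℝ 1 (fderiv ℝ w) := h2.fderiv_right (by norm_num)
    have haff : ∀ z, HasFDerivAt (fun z : Euc n => x + r • z)
        (r • ContinuousLinearMap.id ℝ (Euc n)) z := fun z =>
      ((hasFDerivAt_id z).const_smul r).const_add x
    have e1 : fderiv ℝ (fun z => c * w (x + r • z)) =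
        fun z => (c * r) • fderiv ℝ w (x + r • z) := by
      funext z
      have := (((h2.differentiable (by norm_num) (x + r • z)).hasFDerivAt.comp z
        (haff z)).const_mul c).fderiv
      refine this.trans ?_
      ext v
      simp; ring
    have e2 : negLaplacianPow 1 (fun z => c * w (x + r • z)) =
        fun z => (c * r ^ 2) * negLaplacianPow 1 w (x + r • z) := by
      funext z
      rw [negLaplacianPow_one_apply, negLaplacianPow_one_apply, e1]
      have := (((h1.differentiable (by norm_num) (x + r • z)).hasFDerivAt.comp z
        (haff z)).const_smul (c * r)).fderiv
      have h3 : fderiv ℝ (fun z => (c * r) • fderiv ℝ w (x + r • z)) z = _ := this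
      rw [h3, mul_neg, Finset.mul_sum]
      congr 1
      refine Finset.sum_congr rfl fun i _ => ?_
      simp; ring
    rw [negLaplacianPow_succ k, e2, ih (negLaplacianPow 1 w), negLaplacianPow_succ k w]
    · ring
    · exact contDiff_negLaplacianPow 1 (2 * k) (by convert hw using 2; omega)

/-! ### Radial functions of `e + |y - x|²` -/

/-- The action of `-Δ` on functions `y ↦ F (e + ‖y - x‖²)`. -/
noncomputable def radialOp (n : ℕ) (e : ℝ) (F : ℝ → ℝ) (s : ℝ) : ℝ :=
  -(2 * n * deriv F s + 4 * (s - e) * deriv (deriv F) s)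

lemma contDiffOn_deriv_infty {U : Set ℝ} (hU : IsOpen U) {F : ℝ → ℝ}
    (hF : ContDiffOn ℝ (⊤ : ℕ∞) F U) : ContDiffOn ℝ (⊤ : ℕ∞) (deriv F) U :=
  hF.deriv_of_isOpen hU (by simp)

lemma contDiffOn_radialOp {n : ℕ} {e : ℝ} {U : Set ℝ} (hU : IsOpen U) {F : ℝ → ℝ}
    (hF : ContDiffOn ℝ (⊤ : ℕ∞) F U) : ContDiffOn ℝ (⊤ : ℕ∞) (radialOp n e F) U := by
  have h1 := contDiffOn_deriv_infty hU hF
  have h2 := contDiffOn_deriv_infty hU h1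
  exact ((contDiffOn_const.mul h1).add
    ((contDiffOn_const.mul (contDiffOn_id.sub contDiffOn_const)).mul h2)).neg

lemma radialOp_congr {n : ℕ} {e : ℝ} {U : Set ℝ} (hU : IsOpen U) {F G : ℝ → ℝ}
    (h : EqOn F G U) : EqOn (radialOp n e F) (radialOp n e G) U := by
  have h1 : EqOn (deriv F) (deriv G) U := h.deriv hU
  have h2 : EqOn (deriv (deriv F)) (deriv (deriv G)) U := h1.deriv hU
  intro s hs
  simp [radialOp, h1 hs, h2 hs]

/-- Locality: a differential operator sees only values on the open set. This lets a cutoff be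
replaced by the constant it equals there. -/
lemma iterate_radialOp_congr {n : ℕ} {e : ℝ} {U : Set ℝ} (hU : IsOpen U) {F G : ℝ → ℝ}
    (h : EqOn F G U) (k : ℕ) : EqOn ((radialOp n e)^[k] F) ((radialOp n e)^[k] G) U := by
  induction k generalizing F G with
  | zero => exact h
  | succ k ih => exact ih (radialOp_congr hU h)

lemma radialOp_zero (n : ℕ) (e : ℝ) : radialOp n e (fun _ => 0) = fun _ => 0 := by
  funext s; simp [radialOp]

lemma iterate_radialOp_zero (n : ℕ) (e : ℝ) (k : ℕ) :
    (radialOp n e)^[k] (fun _ => 0) = fun _ => 0 := by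
  induction k with
  | zero => rfl
  | succ k ih => rw [Function.iterate_succ_apply, radialOp_zero, ih]

lemma radialOp_add_const_mul {n : ℕ} {e : ℝ} {U : Set ℝ} (hU : IsOpen U) {F G : ℝ → ℝ} (c : ℝ)
    (hF : ContDiffOn ℝ (⊤ : ℕ∞) F U) (hG : ContDiffOn ℝ (⊤ : ℕ∞) G U) :
    EqOn (radialOp n e (fun s => F s + c * G s))
      (fun s => radialOp n e F s + c * radialOp n e G s) U := by
  have key : ∀ {F G : ℝ → ℝ}, ContDiffOn ℝ (⊤ : ℕ∞) F U → ContDiffOn ℝ (⊤ : ℕ∞) G U →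
      EqOn (deriv (fun s => F s + c * G s)) (fun s => deriv F s + c * deriv G s) U := by
    intro F G hF hG s hs
    have hF' := (hF.differentiableOn (by simp)).differentiableAt (hU.mem_nhds hs)
    have hG' := (hG.differentiableOn (by simp)).differentiableAt (hU.mem_nhds hs)
    exact (hF'.hasDerivAt.add (hG'.hasDerivAt.const_mul c)).deriv
  have h1 := key hF hG
  have h2 := (h1.deriv hU).trans (key (contDiffOn_deriv_infty hU hF) (contDiffOn_deriv_infty hU hG))
  intro s hs
  simp only [radialOp, h1 hs, h2 hs]
  ring

lemma iterate_radialOp_add_const_mul {n : ℕ} {e : ℝ} {U : Set ℝ} (hU : IsOpen U) {F G : ℝ → ℝ}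
    (c : ℝ) (hF : ContDiffOn ℝ (⊤ : ℕ∞) F U) (hG : ContDiffOn ℝ (⊤ : ℕ∞) G U) (k : ℕ) :
    EqOn ((radialOp n e)^[k] (fun s => F s + c * G s))
      (fun s => (radialOp n e)^[k] F s + c * (radialOp n e)^[k] G s) U := by
  induction k generalizing F G with
  | zero => exact fun s _ => rfl
  | succ k ih =>
    exact (iterate_radialOp_congr hU (radialOp_add_const_mul hU c hF hG) k).trans (ih (contDiffOn_radialOp hU hF) (contDiffOn_radialOp hU hG))

/-- The iterates of the radial operator are bounded on compact intervals, uniformly in the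
regularisation parameter. -/
lemma exists_bound_iterate_radialOp (n : ℕ) {F : ℝ → ℝ} (hF : ContDiffOn ℝ (⊤ : ℕ∞) F (Ioi 0))
    (k : ℕ) {a b : ℝ} (ha : 0 < a) :
    ∃ C, 0 ≤ C ∧ ∀ e ∈ Icc (0 : ℝ) 1, ∀ s ∈ Icc a b, |(radialOp n e)^[k] F s| ≤ C := by
  induction k generalizing F with
  | zero =>
    have hs : Icc a b ⊆ Ioi 0 := fun s hs => ha.trans_le hs.1
    obtain ⟨C, hC⟩ := isCompact_Icc.exists_bound_of_continuousOn (hF.continuousOn.mono hs)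
    exact ⟨|C|, abs_nonneg _, fun e _ s hs => (hC s hs).trans (le_abs_self C)⟩
  | succ k ih =>
    have h1 := contDiffOn_deriv_infty isOpen_Ioi hF
    have h2 := contDiffOn_deriv_infty isOpen_Ioi h1
    have hA : ContDiffOn ℝ (⊤ : ℕ∞) (radialOp n 0 F) (Ioi 0) := contDiffOn_radialOp isOpen_Ioi hF
    have hB : ContDiffOn ℝ (⊤ : ℕ∞) (fun s => 4 * deriv (deriv F) s) (Ioi 0) :=
      contDiffOn_const.mul h2
    obtain ⟨C₁, h0, hC₁⟩ := ih hA
    obtain ⟨C₂, h0', hC₂⟩ := ih hB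
    refine ⟨C₁ + C₂, by positivity, fun e he s hs => ?_⟩
    -- The operator is affine in `e`. Splitting the innermost application leaves two functions
    -- independent of `e`, so the induction hypothesis is uniform in `e`.
    have h3 : radialOp n e F = fun s => radialOp n 0 F s + e * (4 * deriv (deriv F) s) := by
      funext s; simp only [radialOp]; ring
    rw [Function.iterate_succ_apply, h3,
      iterate_radialOp_add_const_mul isOpen_Ioi e hA hB k (ha.trans_le hs.1)]
    have h4 : e * |(radialOp n e)^[k] (fun s => 4 * deriv (deriv F) s) s| ≤ 1 * C₂ :=
      mul_le_mul he.2 (hC₂ e he s hs) (abs_nonneg _) zero_le_one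
    calc _ ≤ |(radialOp n e)^[k] (radialOp n 0 F) s|
          + |e * (radialOp n e)^[k] (fun s => 4 * deriv (deriv F) s) s| := abs_add_le _ _
      _ ≤ C₁ + C₂ := by
        rw [abs_mul, abs_of_nonneg he.1]
        linarith [hC₁ e he s hs]

lemma negLaplacianPow_one_radial {n : ℕ} {e : ℝ} (he : 0 < e) {F : ℝ → ℝ}
    (hF : ContDiffOn ℝ (⊤ : ℕ∞) F (Ioi 0)) (x : Euc n) :
    negLaplacianPow 1 (fun y => F (e + ‖y - x‖ ^ 2)) =
      fun y => radialOp n e F (e + ‖y - x‖ ^ 2) := by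
  have hpos : ∀ y : Euc n, e + ‖y - x‖ ^ 2 ∈ Ioi (0 : ℝ) := fun y => by
    have : 0 < e + ‖y - x‖ ^ 2 := by positivity
    exact this
  have hder : ∀ {G : ℝ → ℝ}, ContDiffOn ℝ (⊤ : ℕ∞) G (Ioi 0) → ∀ y : Euc n,
      HasFDerivAt (fun y => G (e + ‖y - x‖ ^ 2))
        ((2 * deriv G (e + ‖y - x‖ ^ 2)) • innerSL ℝ (y - x)) y := by
    intro G hG y
    have hG' := (hG.differentiableOn (by simp)).differentiableAt (isOpen_Ioi.mem_nhds (hpos y))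
    have h1 : HasFDerivAt (fun y : Euc n => e + ‖y - x‖ ^ 2) ((2 : ℝ) • innerSL ℝ (y - x)) y := by
      have := (((hasFDerivAt_id y).sub_const x).norm_sq).const_add e
      refine this.congr_fderiv ?_
      ext v
      simp [two_mul]
    refine (hG'.hasDerivAt.comp_hasFDerivAt y h1).congr_fderiv ?_
    rw [smul_smul, mul_comm]
  have h1 := contDiffOn_deriv_infty isOpen_Ioi hF
  have e1 : fderiv ℝ (fun y : Euc n => F (e + ‖y - x‖ ^ 2)) =
      fun y => (2 * deriv F (e + ‖y - x‖ ^ 2)) • innerSL ℝ (y - x) :=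
    funext fun y => (hder hF y).fderiv
  funext y
  have e2 : HasFDerivAt (fun y : Euc n => (2 * deriv F (e + ‖y - x‖ ^ 2)) • innerSL ℝ (y - x))
      _ y := ((hder h1 y).const_mul 2).smul
    (((innerSL ℝ (E := Euc n)).hasFDerivAt).comp y ((hasFDerivAt_id y).sub_const x))
  rw [negLaplacianPow_one_apply, e1, e2.fderiv]
  have h3 : ∑ i, (inner ℝ (y - x) (EuclideanSpace.basisFun (Fin n) ℝ i)) ^ 2 = ‖y - x‖ ^ 2 := by
    rw [← (EuclideanSpace.basisFun (Fin n) ℝ).sum_sq_norm_inner_left (y - x)]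
    simp
  simp only [radialOp]
  have h4 : ∀ i : Fin n, 2 * deriv F (e + ‖y - x‖ ^ 2) *
      innerSL ℝ (EuclideanSpace.basisFun (Fin n) ℝ i) (EuclideanSpace.basisFun (Fin n) ℝ i) =
      2 * deriv F (e + ‖y - x‖ ^ 2) := fun i => by simp [innerSL_apply_apply]
  have h5 : ∀ i : Fin n, 2 * (2 * deriv (deriv F) (e + ‖y - x‖ ^ 2) *
      inner ℝ (y - x) (EuclideanSpace.basisFun (Fin n) ℝ i)) *
      inner ℝ (y - x) (EuclideanSpace.basisFun (Fin n) ℝ i) =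
      4 * deriv (deriv F) (e + ‖y - x‖ ^ 2) *
      inner ℝ (y - x) (EuclideanSpace.basisFun (Fin n) ℝ i) ^ 2 := fun i => by ring
  simp only [add_apply, smul_apply,
    ContinuousLinearMap.smulRight_apply, innerSL_apply_apply, smul_eq_mul,
    ContinuousLinearMap.comp_apply, ContinuousLinearMap.id_apply]
  rw [Finset.sum_add_distrib, Finset.sum_congr rfl (fun i _ => h4 i),
    Finset.sum_congr rfl (fun i _ => h5 i), Finset.sum_const,
    Finset.card_univ, Fintype.card_fin, nsmul_eq_mul, ← Finset.mul_sum, h3]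
  ring

/-- Since `e > 0`, the argument stays in `(0, ∞)`, so profiles singular at `0`, such as negative
powers, are allowed. -/
theorem negLaplacianPow_radial {n : ℕ} {e : ℝ} (he : 0 < e) (k : ℕ) {F : ℝ → ℝ}
    (hF : ContDiffOn ℝ (⊤ : ℕ∞) F (Ioi 0)) (x : Euc n) :
    negLaplacianPow k (fun y => F (e + ‖y - x‖ ^ 2)) =
      fun y => (radialOp n e)^[k] F (e + ‖y - x‖ ^ 2) := by
  induction k generalizing F with
  | zero => rfl
  | succ k ih =>
    rw [negLaplacianPow_succ k, negLaplacianPow_one_radial he hF,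
      ih (contDiffOn_radialOp isOpen_Ioi hF)]
    rfl

lemma contDiff_radial {n : ℕ} {e : ℝ} (he : 0 < e) {F : ℝ → ℝ}
    (hF : ContDiffOn ℝ (⊤ : ℕ∞) F (Ioi 0)) (x : Euc n) :
    ContDiff ℝ (⊤ : ℕ∞) (fun y : Euc n => F (e + ‖y - x‖ ^ 2)) := by
  rw [← contDiffOn_univ]
  refine hF.comp (t := Ioi 0) (g := F) (f := fun y : Euc n => e + ‖y - x‖ ^ 2) ?_ fun y _ => ?_
  · exact (contDiff_const.add ((contDiff_id.sub contDiff_const).norm_sq ℝ)).contDiffOn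
  · have : 0 < e + ‖y - x‖ ^ 2 := by positivity
    exact this

/-! ### Explicit iterates on powers -/

/-- The rising factorial `a (a + 1) ⋯ (a + m - 1)`. -/
noncomputable def risingFactorial (a : ℝ) (m : ℕ) : ℝ := ∏ i ∈ Finset.range m, (a + i)

lemma risingFactorial_succ (a : ℝ) (m : ℕ) :
    risingFactorial a (m + 1) = risingFactorial a m * (a + m) := Finset.prod_range_succ _ _

lemma risingFactorial_succ' (a : ℝ) (m : ℕ) :
    risingFactorial a (m + 1) = a * risingFactorial (a + 1) m := by
  rw [risingFactorial, Finset.prod_range_succ', mul_comm]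
  simp only [risingFactorial, Nat.cast_zero, add_zero, Nat.cast_succ]
  congr 1
  exact Finset.prod_congr rfl fun i _ => by ring

lemma risingFactorial_pos {a : ℝ} (ha : 0 < a) (m : ℕ) : 0 < risingFactorial a m :=
  Finset.prod_pos fun i _ => by positivity

/-- The coefficients of `(-Δ)^k (e + |x|²)^(-a)` in powers of `e + |x|²`. -/
noncomputable def polyCoeff (n k : ℕ) (a : ℝ) (j : ℕ) : ℝ :=
  4 ^ k * k.choose j * risingFactorial a (k + j) * risingFactorial (n / 2 - a - k) (k - j)

lemma contDiffOn_rpow_neg (a : ℝ) : ContDiffOn ℝ (⊤ : ℕ∞) (fun s : ℝ => s ^ (-a)) (Ioi 0) :=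
  fun _ hs => (Real.contDiffAt_rpow_const_of_ne hs.ne').contDiffWithinAt

lemma deriv_sum_rpow {ι : Type*} (S : Finset ι) (c b : ι → ℝ) :
    EqOn (deriv (fun s : ℝ => ∑ j ∈ S, c j * s ^ (-b j)))
      (fun s => ∑ j ∈ S, (c j * (-b j)) * s ^ (-(b j + 1))) (Ioi 0) := by
  intro s hs
  refine (HasDerivAt.fun_sum (u := S) (A := fun j s => c j * s ^ (-b j))
    (A' := fun j => (c j * (-b j)) * s ^ (-(b j + 1))) fun j _ => ?_).deriv
  have := (Real.hasDerivAt_rpow_const (p := -b j) (Or.inl hs.ne')).const_mul (c j)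
  refine this.congr_deriv ?_
  rw [neg_add, ← sub_eq_add_neg]
  ring

lemma radialOp_sum_rpow (n : ℕ) (e : ℝ) {ι : Type*} (S : Finset ι) (c b : ι → ℝ) :
    EqOn (radialOp n e (fun s : ℝ => ∑ j ∈ S, c j * s ^ (-b j)))
      (fun s => ∑ j ∈ S, c j * (4 * b j * (n / 2 - 1 - b j) * s ^ (-(b j + 1)) +
        4 * e * b j * (b j + 1) * s ^ (-(b j + 2)))) (Ioi 0) := by
  intro s hs
  have h1 := deriv_sum_rpow S c b
  have h2 := (h1.deriv isOpen_Ioi).trans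
    (deriv_sum_rpow S (fun j => c j * (-b j)) (fun j => b j + 1))
  rw [radialOp, h1 hs, h2 hs, Finset.mul_sum, Finset.mul_sum, ← Finset.sum_add_distrib,
    ← Finset.sum_neg_distrib]
  refine Finset.sum_congr rfl fun j _ => ?_
  -- In `4(s - e)F''` the part with `s` lowers the singularity by one and merges with the
  -- first-order term; the part with `e` does not.
  have h3 : s ^ (-(b j + 1)) = s * s ^ (-(b j + 2)) := by
    rw [show -(b j + 1) = 1 + -(b j + 2) by ring, Real.rpow_add hs, Real.rpow_one]
  rw [show b j + 1 + 1 = b j + 2 by ring, h3]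
  ring

lemma polyCoeff_succ_zero (n k : ℕ) (a : ℝ) :
    polyCoeff n (k + 1) a 0 = polyCoeff n k a 0 * (4 * (a + k) * (n / 2 - 1 - (a + k))) := by
  simp only [polyCoeff, Nat.choose_zero_right, add_zero, Nat.sub_zero, Nat.cast_add, Nat.cast_one]
  rw [risingFactorial_succ, risingFactorial_succ',
    show (n / 2 - a - (k + 1 : ℝ) + 1) = n / 2 - a - k by ring]
  ring

/-- Pascal's rule combined with `C(k,j+1)(j+1) = C(k,j)(k-j)`. With `y = n/2 - a - k - 1`, all the
second rising factorials start at `y` or `y + 1` and differ only in end factors. When `j = k` the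
coefficient of index `k + 1` vanishes and is treated apart. -/
lemma polyCoeff_succ_succ (n k : ℕ) (a : ℝ) {j : ℕ} (hj : j ≤ k) :
    polyCoeff n (k + 1) a (j + 1) =
      polyCoeff n k a (j + 1) * (4 * (a + k + (j + 1 : ℕ)) * (n / 2 - 1 - (a + k + (j + 1 : ℕ)))) +
      polyCoeff n k a j * (4 * (a + k + j) * (a + k + j + 1)) := by
  obtain ⟨y, hy⟩ : ∃ y : ℝ, y = n / 2 - a - k - 1 := ⟨_, rfl⟩
  have e1 : (n / 2 - a - k : ℝ) = y + 1 := by rw [hy]; ring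
  have e2 : (n / 2 - a - (k + 1 : ℕ) : ℝ) = y := by rw [hy]; push_cast; ring
  have e3 : (n / 2 - 1 - (a + k + (j + 1 : ℕ)) : ℝ) = y - (j + 1) := by rw [hy]; push_cast; ring
  simp only [polyCoeff, e1, e2, e3]
  have e4 : risingFactorial a (k + 1 + (j + 1)) =
      risingFactorial a (k + j) * (a + k + j) * (a + k + j + 1) := by
    rw [show k + 1 + (j + 1) = k + j + 1 + 1 by ring, risingFactorial_succ, risingFactorial_succ]
    push_cast; ring
  have e5 : risingFactorial a (k + (j + 1)) = risingFactorial a (k + j) * (a + k + j) := by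
    rw [← add_assoc, risingFactorial_succ]; push_cast; ring
  rw [e4, e5, Nat.choose_succ_succ]
  rcases hj.eq_or_lt with rfl | hlt
  · simp [risingFactorial]; ring
  · obtain ⟨m, rfl⟩ := Nat.exists_eq_add_of_lt hlt
    have hc := Nat.choose_succ_right_eq (j + m + 1) j
    rw [show j + m + 1 - j = m + 1 by omega] at hc
    have hc' : ((j + m + 1).choose (j + 1) : ℝ) * (j + 1) = (j + m + 1).choose j * (m + 1) := by
      exact_mod_cast hc
    rw [show j + m + 1 - (j + 1) = m by omega, show j + m + 1 - j = m + 1 by omega,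
      show j + m + 1 + 1 - (j + 1) = m + 1 by omega, risingFactorial_succ',
      risingFactorial_succ (y + 1)]
    push_cast
    linear_combination (4 * 4 ^ (j + m + 1) * risingFactorial a (j + m + 1 + j) *
      (a + (j + m + 1) + j) * (a + (j + m + 1) + j + 1) * risingFactorial (y + 1) m) * hc'

/-- The explicit expansion of `(-Δ)^k (e + |x|²)^(-a)`. -/
theorem iterate_radialOp_rpow (n k : ℕ) (e a : ℝ) :
    EqOn ((radialOp n e)^[k] (fun s => s ^ (-a)))
      (fun s => ∑ j ∈ Finset.range (k + 1), polyCoeff n k a j * e ^ j * s ^ (-(a + k + j)))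
      (Ioi 0) := by
  induction k with
  | zero => intro s _; simp [polyCoeff, risingFactorial]
  | succ k ih =>
    rw [Function.iterate_succ_apply']
    refine (radialOp_congr isOpen_Ioi ih).trans ((radialOp_sum_rpow n e _ _ _).trans ?_)
    intro s _
    -- Appending this zero term gives the two sums the index ranges required by the recursion.
    have hT : polyCoeff n k a (k + 1) = 0 := by simp [polyCoeff]
    simp only
    rw [Finset.sum_range_succ' _ (k + 1)]
    have h0 : ∑ j ∈ Finset.range (k + 1), polyCoeff n k a j * e ^ j *
        (4 * (a + k + j) * (n / 2 - 1 - (a + k + j)) * s ^ (-(a + k + j + 1)) +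
        4 * e * (a + k + j) * (a + k + j + 1) * s ^ (-(a + k + j + 2))) =
        ∑ j ∈ Finset.range (k + 2), polyCoeff n k a j *
          (4 * (a + k + j) * (n / 2 - 1 - (a + k + j))) * e ^ j * s ^ (-(a + k + j + 1)) +
        ∑ j ∈ Finset.range (k + 1), polyCoeff n k a j * (4 * (a + k + j) * (a + k + j + 1)) *
          e ^ (j + 1) * s ^ (-(a + k + j + 2)) := by
      rw [Finset.sum_range_succ _ (k + 1), hT]
      simp only [zero_mul, add_zero]
      rw [← Finset.sum_add_distrib]
      exact Finset.sum_congr rfl fun j _ => by ring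
    rw [h0, Finset.sum_range_succ' _ (k + 1), add_right_comm, ← Finset.sum_add_distrib]
    congr 1
    · refine Finset.sum_congr rfl fun j hj => ?_
      rw [polyCoeff_succ_succ n k a (Nat.lt_succ_iff.1 (Finset.mem_range.1 hj))]
      rw [show -(a + k + ((j + 1 : ℕ) : ℝ) + 1) = -(a + (k + 1 : ℕ) + (j + 1 : ℕ)) by
        push_cast; ring, show -(a + k + (j : ℝ) + 2) = -(a + (k + 1 : ℕ) + (j + 1 : ℕ)) by
        push_cast; ring]
      ring
    · rw [polyCoeff_succ_zero]
      simp only [Nat.cast_zero, add_zero, pow_zero, mul_one, Nat.cast_add, Nat.cast_one]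
      rw [add_assoc]

/-- The condition `a < n/2 - k` makes the second rising factorial start at a positive number; this
is where the exponent condition of the theorem enters the existence half. -/
lemma polyCoeff_pos {n k : ℕ} {a : ℝ} (ha : 0 < a) (hak : a < n / 2 - k) {j : ℕ} (hj : j ≤ k) :
    0 < polyCoeff n k a j := by
  have := Nat.choose_pos hj
  have h1 := risingFactorial_pos ha (k + j)
  have h2 : 0 < risingFactorial (n / 2 - a - k) (k - j) := risingFactorial_pos (by linarith) _
  unfold polyCoeff
  positivity

/-- At the critical exponent only one term survives. -/
lemma iterate_radialOp_rpow_critical (n k : ℕ) (e : ℝ) {s : ℝ} (hs : 0 < s) :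
    (radialOp n e)^[k] (fun s => s ^ (-((n : ℝ) / 2 - k))) s =
      4 ^ k * risingFactorial (n / 2 - k) (k + k) * e ^ k * s ^ (-((n : ℝ) / 2 + k)) := by
  rw [iterate_radialOp_rpow n k e _ hs]
  simp only
  rw [Finset.sum_range_succ, Finset.sum_eq_zero, zero_add]
  · simp only [polyCoeff, Nat.choose_self, Nat.cast_one, mul_one, Nat.sub_self]
    rw [show (n : ℝ) / 2 - k + k + k = n / 2 + k by ring]
    simp [risingFactorial]
  · intro j hj
    -- Here the second rising factorial starts at `0`, so it vanishes unless it is the empty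
    -- product, that is unless `j = k`.
    obtain ⟨m, hm⟩ : ∃ m, k - j = m + 1 := ⟨k - j - 1, by have := Finset.mem_range.1 hj; omega⟩
    simp [polyCoeff, hm, risingFactorial_succ']

/-! ### Existence: bubbles -/

/-- The bubble `(1 + |x|²)^(-a)`. -/
noncomputable def bubble (n : ℕ) (a : ℝ) (x : Euc n) : ℝ := (1 + ‖x‖ ^ 2) ^ (-a)

lemma bubble_pos (n : ℕ) (a : ℝ) (x : Euc n) : 0 < bubble n a x :=
  Real.rpow_pos_of_pos (by positivity) _

lemma bubble_eq_radial (n : ℕ) (a : ℝ) :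
    bubble n a = fun y => (fun s : ℝ => s ^ (-a)) (1 + ‖y - 0‖ ^ 2) := by
  funext y; simp [bubble]

lemma contDiff_bubble (n : ℕ) (a : ℝ) (m : ℕ) :
    ContDiff ℝ (m : WithTop ℕ∞) (bubble n a) := by
  rw [bubble_eq_radial]
  exact contDiff_infty.1 (contDiff_radial one_pos (contDiffOn_rpow_neg a) 0) m

/-- With `e = 1` all terms of the expansion are positive. The term `j = 0` alone gives the lower
bound; as `1 + |x|² ≥ 1`, each term is at most its coefficient times the slowest decaying power. -/
lemma negLaplacianPow_bubble_bounds {n k : ℕ} {a : ℝ} (ha : 0 < a) (hak : a < n / 2 - k) :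
    ∃ m M : ℝ, 0 < m ∧ ∀ x : Euc n, m * bubble n (a + k) x ≤ negLaplacianPow k (bubble n a) x ∧
      negLaplacianPow k (bubble n a) x ≤ M * bubble n (a + k) x := by
  refine ⟨polyCoeff n k a 0, ∑ j ∈ Finset.range (k + 1), polyCoeff n k a j,
    polyCoeff_pos ha hak (Nat.zero_le k), fun x => ?_⟩
  have hs : (1 : ℝ) ≤ 1 + ‖x‖ ^ 2 := by nlinarith [sq_nonneg ‖x‖]
  have h0 : (0 : ℝ) < 1 + ‖x‖ ^ 2 := by linarith
  have key : negLaplacianPow k (bubble n a) x = ∑ j ∈ Finset.range (k + 1),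
      polyCoeff n k a j * (1 + ‖x‖ ^ 2) ^ (-(a + k + j)) := by
    rw [bubble_eq_radial, negLaplacianPow_radial one_pos k (contDiffOn_rpow_neg a) 0]
    simp only [sub_zero]
    rw [iterate_radialOp_rpow n k 1 a h0]
    simp
  have hpos : ∀ j ∈ Finset.range (k + 1), 0 < polyCoeff n k a j := fun j hj =>
    polyCoeff_pos ha hak (Nat.lt_succ_iff.1 (Finset.mem_range.1 hj))
  rw [key]
  constructor
  · refine le_trans (le_of_eq ?_) (Finset.single_le_sum (f := fun j =>
      polyCoeff n k a j * (1 + ‖x‖ ^ 2) ^ (-(a + k + j))) (fun j hj => ?_)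
      (Finset.mem_range.2 (Nat.succ_pos k)))
    · simp [bubble]
    · exact mul_nonneg (hpos j hj).le (Real.rpow_nonneg h0.le _)
  · rw [Finset.sum_mul]
    refine Finset.sum_le_sum fun j hj => mul_le_mul_of_nonneg_left ?_ (hpos j hj).le
    refine Real.rpow_le_rpow_of_exponent_le hs ?_
    have : (0 : ℝ) ≤ j := Nat.cast_nonneg j
    linarith

lemma doubleBounded_div {X : Type*} {h g : X → ℝ} {m M : ℝ} (hm : 0 < m) (hg : ∀ x, 0 < g x)
    (hh : ∀ x, m * g x ≤ h x ∧ h x ≤ M * g x) : DoubleBounded fun x => h x / g x := by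
  refine ⟨max (1 / m) (max M 1), by positivity, fun x => ⟨?_, ?_⟩⟩
  · refine le_trans ?_ ((le_div_iff₀ (hg x)).2 (hh x).1)
    rw [one_div_le (by positivity) hm]
    exact le_max_left _ _
  · exact ((div_le_iff₀ (hg x)).2 (hh x).2).trans ((le_max_left _ _).trans (le_max_right _ _))

/-- A pair of bubbles with matching decay rates solves the system. -/
lemma bubble_system {n k : ℕ} {p q a b : ℝ} (ha : 0 < a) (hb : 0 < b) (hak : a < n / 2 - k)
    (hbk : b < n / 2 - k) (hab : a + k = b * q) (hba : b + k = a * p) :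
    DoubleBounded (fun x => negLaplacianPow k (bubble n a) x / bubble n b x ^ q) ∧
    DoubleBounded (fun x => negLaplacianPow k (bubble n b) x / bubble n a x ^ p) ∧
    IsPositiveSystemSolution k p q
      (fun x => negLaplacianPow k (bubble n a) x / bubble n b x ^ q)
      (fun x => negLaplacianPow k (bubble n b) x / bubble n a x ^ p) (bubble n a) (bubble n b) := by
  have hpow : ∀ (c r : ℝ) (x : Euc n), bubble n c x ^ r = bubble n (c * r) x := fun c r x => by
    rw [bubble, bubble, ← Real.rpow_mul (by positivity), neg_mul]
  obtain ⟨m₁, M₁, hm₁, h₁⟩ := negLaplacianPow_bubble_bounds ha hak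
  obtain ⟨m₂, M₂, hm₂, h₂⟩ := negLaplacianPow_bubble_bounds hb hbk
  -- The relations between exponents turn `v^q` and `u^p` into the bubbles of exponents `a + k` and
  -- `b + k`.
  simp only [hpow, ← hab, ← hba]
  refine ⟨doubleBounded_div hm₁ (bubble_pos n _) h₁, doubleBounded_div hm₂ (bubble_pos n _) h₂,
    contDiff_bubble n a _, contDiff_bubble n b _, bubble_pos n a, bubble_pos n b,
    fun x => ?_, fun x => ?_⟩
  · rw [hpow, ← hab, div_mul_cancel₀ _ (bubble_pos n _ x).ne']
  · rw [hpow, ← hba, div_mul_cancel₀ _ (bubble_pos n _ x).ne']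

/-- The bubble exponents are half the scaling exponents, the unique solution of `a + k = bq`, `b + k
= ap`; the hypothesis says that both are below `n/2 - k`. -/
theorem exists_system_solution {n k : ℕ} (hk : 1 ≤ k) {p q : ℝ} (hp : 0 < p) (hq : 0 < q)
    (hpq : 1 < p * q)
    (h : max (2 * (k : ℝ) * (p + 1) / (p * q - 1)) (2 * (k : ℝ) * (q + 1) / (p * q - 1))
      < (n : ℝ) - 2 * (k : ℝ)) :
    ∃ c₁ c₂ u v : Euc n → ℝ,
      DoubleBounded c₁ ∧ DoubleBounded c₂ ∧ IsPositiveSystemSolution k p q c₁ c₂ u v := by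
  have hk' : (0 : ℝ) < k := by exact_mod_cast hk
  have hd : 0 < p * q - 1 := by linarith
  obtain ⟨h1, h2⟩ := max_lt_iff.1 h
  have e1 : 2 * (k : ℝ) * (p + 1) / (p * q - 1) = 2 * (k * (p + 1) / (p * q - 1)) := by ring
  have e2 : 2 * (k : ℝ) * (q + 1) / (p * q - 1) = 2 * (k * (q + 1) / (p * q - 1)) := by ring
  exact ⟨_, _, _, _, bubble_system (a := k * (q + 1) / (p * q - 1)) (b := k * (p + 1) / (p * q - 1))
    (by positivity) (by positivity) (by linarith) (by linarith)
    (by rw [div_mul_eq_mul_div, eq_div_iff hd.ne', add_mul, div_mul_cancel₀ _ hd.ne']; ring)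
    (by rw [div_mul_eq_mul_div, eq_div_iff hd.ne', add_mul, div_mul_cancel₀ _ hd.ne']; ring)⟩

theorem exists_scalar_solution {n k : ℕ} (hk : 1 ≤ k) (hkn : (k : ℝ) < n / 2) {p : ℝ} (hp : 1 < p)
    (h : (n : ℝ) / ((n : ℝ) - 2 * (k : ℝ)) < p) :
    ∃ c u : Euc n → ℝ, DoubleBounded c ∧ IsPositiveSolution k p c u := by
  have hk' : (0 : ℝ) < k := by exact_mod_cast hk
  have hd : 0 < p - 1 := by linarith
  have hlt : (k : ℝ) / (p - 1) < n / 2 - k := by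
    rw [div_lt_iff₀ (by linarith)] at h
    rw [div_lt_iff₀ hd]
    linarith
  have hab : (k : ℝ) / (p - 1) + k = k / (p - 1) * p := by field_simp; ring
  have ha : 0 < (k : ℝ) / (p - 1) := by positivity
  obtain ⟨h1, -, h3⟩ := bubble_system ha ha hlt hlt hab hab
  exact ⟨_, _, h1, h3.contDiff_fst, h3.pos_fst, h3.eq_fst⟩

/-! ### Cutoffs and the mass of `(-Δ)^k w` -/

open Metric

/-- A smooth cutoff on the line: `1` on `(-∞, 2]`, `0` on `[3, ∞)`. -/
noncomputable def lineCutoff (s : ℝ) : ℝ := Real.smoothTransition (3 - s)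

lemma contDiff_lineCutoff : ContDiff ℝ (⊤ : ℕ∞) lineCutoff :=
  Real.smoothTransition.contDiff.comp (contDiff_const.sub contDiff_id)

lemma lineCutoff_eq_one {s : ℝ} (hs : s ≤ 2) : lineCutoff s = 1 :=
  Real.smoothTransition.one_of_one_le (by linarith)

lemma lineCutoff_eq_zero {s : ℝ} (hs : 3 ≤ s) : lineCutoff s = 0 :=
  Real.smoothTransition.zero_of_nonpos (by linarith)

lemma lineCutoff_nonneg (s : ℝ) : 0 ≤ lineCutoff s := Real.smoothTransition.nonneg _

lemma lineCutoff_le_one (s : ℝ) : lineCutoff s ≤ 1 := Real.smoothTransition.le_one _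

lemma hasCompactSupport_radial {n : ℕ} {e : ℝ} (he : 0 < e) {F : ℝ → ℝ}
    (hF : ∀ s, 3 ≤ s → F s = 0) (x : Euc n) :
    HasCompactSupport (fun y : Euc n => F (e + ‖y - x‖ ^ 2)) := by
  refine HasCompactSupport.of_support_subset_isCompact (isCompact_closedBall x 2) fun y hy => ?_
  by_contra hy'
  refine hy (hF _ ?_)
  rw [mem_closedBall, dist_eq_norm, not_le] at hy'
  nlinarith

lemma iterate_radialOp_const_one (n : ℕ) (e : ℝ) {k : ℕ} (hk : 1 ≤ k) :
    (radialOp n e)^[k] (fun _ => 1) = fun _ => 0 := by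
  obtain ⟨m, rfl⟩ := Nat.exists_eq_add_of_le' hk
  have : radialOp n e (fun _ => 1) = fun _ => 0 := by funext s; simp [radialOp]
  rw [Function.iterate_succ_apply, this, iterate_radialOp_zero]

/-- The mass of `(-Δ)^k w` in the unit ball is controlled by `w` in the surrounding annulus. -/
theorem setIntegral_negLaplacianPow_le (n : ℕ) {k : ℕ} (hk : 1 ≤ k) :
    ∃ C : ℝ, 0 ≤ C ∧ ∀ w : Euc n → ℝ, ContDiff ℝ ((2 * k : ℕ) : WithTop ℕ∞) w → (∀ x, 0 ≤ w x) →
      (∀ x, 0 ≤ negLaplacianPow k w x) →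
      ∫ x in closedBall 0 1, negLaplacianPow k w x ≤ C * ∫ x in closedBall 0 2 \ ball 0 1, w x := by
  have hθ : ContDiffOn ℝ (⊤ : ℕ∞) lineCutoff (Ioi 0) := contDiff_lineCutoff.contDiffOn
  obtain ⟨C, hC0, hC⟩ := exists_bound_iterate_radialOp n hθ k (a := 2) (b := 5) (by norm_num)
  refine ⟨C, hC0, fun w hw hw0 hg => ?_⟩
  set g := negLaplacianPow k w with hgdef
  have hgc : Continuous g := (contDiff_negLaplacianPow k 0 hw).continuous
  have hwc : Continuous w := hw.continuous
  -- This equals `1` for `|y| ≤ 1` and `0` for `|y|² ≥ 2`. On the annulus `1 ≤ |y| ≤ 2` the argument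
  -- lies in `[2, 5]`, the interval where the iterates were bounded.
  set ψ : Euc n → ℝ := fun y => lineCutoff (1 + ‖y - 0‖ ^ 2) with hψ
  have hψs : ContDiff ℝ (⊤ : ℕ∞) ψ := contDiff_radial one_pos hθ 0
  have hψc : HasCompactSupport ψ := hasCompactSupport_radial one_pos (fun s => lineCutoff_eq_zero) 0
  have hψ0 : ∀ y, 0 ≤ ψ y := fun y => lineCutoff_nonneg _
  have hLψ : ∀ y, negLaplacianPow k ψ y = (radialOp n 1)^[k] lineCutoff (1 + ‖y‖ ^ 2) := fun y => by
    rw [hψ, negLaplacianPow_radial one_pos k hθ 0]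
    simp only [sub_zero]
  have hin : ∀ y ∈ ball (0 : Euc n) 1, negLaplacianPow k ψ y = 0 := by
    intro y hy
    rw [mem_ball_zero_iff] at hy
    rw [hLψ, iterate_radialOp_congr isOpen_Iio (G := fun _ => 1)
      (fun s hs => lineCutoff_eq_one (le_of_lt hs)) k (show 1 + ‖y‖ ^ 2 ∈ Iio 2 by
        rw [mem_Iio]; nlinarith [norm_nonneg y]), iterate_radialOp_const_one n 1 hk]
  have hout : ∀ y ∉ closedBall (0 : Euc n) 2, negLaplacianPow k ψ y = 0 := by
    intro y hy
    rw [mem_closedBall_zero_iff, not_le] at hy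
    rw [hLψ, iterate_radialOp_congr isOpen_Ioi (G := fun _ => 0)
      (fun s hs => lineCutoff_eq_zero (le_of_lt hs)) k (show 1 + ‖y‖ ^ 2 ∈ Ioi 3 by
        rw [mem_Ioi]; nlinarith [norm_nonneg y]), iterate_radialOp_zero]
  have hA : MeasurableSet (closedBall (0 : Euc n) 2 \ ball 0 1) :=
    measurableSet_closedBall.diff measurableSet_ball
  have hwA : IntegrableOn w (closedBall (0 : Euc n) 2 \ ball 0 1) :=
    (hwc.continuousOn.integrableOn_compact (isCompact_closedBall 0 2)).mono_set sdiff_subset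
  have hgψ : Integrable fun y => g y * ψ y :=
    (hgc.mul hψs.continuous).integrable_of_hasCompactSupport hψc.mul_left
  have hbd : ∀ y, w y * negLaplacianPow k ψ y ≤
      (closedBall (0 : Euc n) 2 \ ball 0 1).indicator (fun y => C * w y) y := by
    intro y
    by_cases hy : y ∈ closedBall (0 : Euc n) 2 \ ball 0 1
    · rw [indicator_of_mem hy, mul_comm C]
      refine mul_le_mul_of_nonneg_left ?_ (hw0 y)
      rw [hLψ]
      refine (le_abs_self _).trans (hC 1 ⟨zero_le_one, le_rfl⟩ _ ?_)
      have h1 := mem_closedBall_zero_iff.1 hy.1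
      have h2 : 1 ≤ ‖y‖ := by simpa using hy.2
      constructor <;> nlinarith
    · rw [indicator_of_notMem hy]
      by_cases hy2 : y ∈ closedBall (0 : Euc n) 2
      · rw [hin y (by by_contra h; exact hy ⟨hy2, h⟩), mul_zero]
      · rw [hout y hy2, mul_zero]
  calc ∫ x in closedBall 0 1, g x = ∫ x in closedBall 0 1, g x * ψ x := by
        refine setIntegral_congr_fun measurableSet_closedBall fun y hy => ?_
        have h1 := mem_closedBall_zero_iff.1 hy
        have h2 : ψ y = 1 := lineCutoff_eq_one (by rw [sub_zero]; nlinarith [norm_nonneg y])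
        simp [h2]
    _ ≤ ∫ x, g x * ψ x :=
        setIntegral_le_integral hgψ (ae_of_all _ fun y => mul_nonneg (hg y) (hψ0 y))
    _ = ∫ x, w x * negLaplacianPow k ψ x := (integral_mul_negLaplacianPow k hw hψs hψc).symm
    _ ≤ ∫ x, (closedBall (0 : Euc n) 2 \ ball 0 1).indicator (fun y => C * w y) x := by
        refine integral_mono ?_ ((integrable_indicator_iff hA).2 (hwA.const_mul C)) hbd
        exact (hwc.mul (contDiff_infty_negLaplacianPow k
          hψs).continuous).integrable_of_hasCompactSupport (hψc.negLaplacianPow k).mul_left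
    _ = _ := by rw [integral_indicator hA, integral_const_mul]

/-! ### Pointwise bounds by truncated Riesz potentials -/

/-- The Riesz kernel of order `2k`, truncated to the ball of radius `2`. -/
noncomputable def truncRiesz (n k : ℕ) : Euc n → ℝ :=
  (closedBall 0 2).indicator fun z => ‖z‖ ^ (-((n : ℝ) - 2 * k))

lemma truncRiesz_nonneg (n k : ℕ) (z : Euc n) : 0 ≤ truncRiesz n k z :=
  indicator_nonneg (fun _ _ => Real.rpow_nonneg (norm_nonneg _) _) z

lemma measurable_truncRiesz (n k : ℕ) : Measurable (truncRiesz n k) :=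
  (measurable_norm.pow_const _).indicator measurableSet_closedBall

lemma integrable_truncRiesz {n k : ℕ} (hk : 1 ≤ k) (hkn : (k : ℝ) < n / 2) :
    Integrable (truncRiesz n k) := by
  have hk' : (1 : ℝ) ≤ k := by exact_mod_cast hk
  rw [truncRiesz, integrable_indicator_iff measurableSet_closedBall]
  refine IntegrableOn.mono_set (t := ball 0 3) ?_ (closedBall_subset_ball (by norm_num))
  refine integrableOn_ball_of_norm_le_rpow (C := 1) (α := (n : ℝ) - 2 * k) ?_ ?_ ?_ ?_
  · rw [finrank_euclideanSpace_fin]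
    have : (1 : ℝ) ≤ n := by linarith
    exact_mod_cast this
  · rw [finrank_euclideanSpace_fin]; linarith
  · refine ae_of_all _ fun x => ?_
    rw [one_mul, Real.norm_of_nonneg (Real.rpow_nonneg (norm_nonneg _) _)]
  · exact (measurable_norm.pow_const _).aestronglyMeasurable

lemma contDiffOn_cutoff_rpow (a : ℝ) :
    ContDiffOn ℝ (⊤ : ℕ∞) (fun s : ℝ => lineCutoff s * s ^ (-a)) (Ioi 0) :=
  contDiff_lineCutoff.contDiffOn.mul (contDiffOn_rpow_neg a)

/-- Lower bound for a nonnegative function by testing with the regularised, truncated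
fundamental solution. -/
theorem setIntegral_closedBall_le_potential {n k : ℕ} (hkn : (k : ℝ) < n / 2) :
    ∃ c C : ℝ, 0 < c ∧ 0 ≤ C ∧ ∀ w : Euc n → ℝ, ContDiff ℝ ((2 * k : ℕ) : WithTop ℕ∞) w →
      (∀ x, 0 ≤ w x) → (∀ x, 0 ≤ negLaplacianPow k w x) → ∀ x, ∀ t ∈ Ioo (0 : ℝ) 1,
      ENNReal.ofReal (c * t ^ (-(n : ℝ)) * ∫ y in closedBall x t, w y) ≤
        (∫⁻ y, ENNReal.ofReal (negLaplacianPow k w y * truncRiesz n k (y - x))) +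
        ENNReal.ofReal (C * ∫ y in closedBall x 2, w y) := by
  have ha : 0 < (n : ℝ) / 2 - k := by linarith
  set a : ℝ := (n : ℝ) / 2 - k with hadef
  set F : ℝ → ℝ := fun s => lineCutoff s * s ^ (-a) with hFdef
  have hF : ContDiffOn ℝ (⊤ : ℕ∞) F (Ioi 0) := contDiffOn_cutoff_rpow a
  obtain ⟨C, hC0, hC⟩ := exists_bound_iterate_radialOp n hF k (a := 2) (b := 5) (by norm_num)
  set c₀ : ℝ := 4 ^ k * risingFactorial a (k + k) with hc₀
  have hc₀pos : 0 < c₀ := mul_pos (by positivity) (risingFactorial_pos ha _)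
  -- Near `x` the operator applied to the test function with `e = t²` is exactly `c₀ t^(2k)
  -- s^(-(n/2+k))`, a positive approximate identity. On `B_t(x)` one has `s ≤ 2t²`, which gives the
  -- constant and the factor `t^(-n)`.
  refine ⟨c₀ * 2 ^ (-((n : ℝ) / 2 + k)), C, by positivity, hC0, fun w hw hw0 hg x t ht => ?_⟩
  have he : 0 < t ^ 2 := by have := ht.1; positivity
  have he1 : t ^ 2 < 1 := by nlinarith [ht.1, ht.2]
  set g := negLaplacianPow k w with hgdef
  have hgc : Continuous g := (contDiff_negLaplacianPow k 0 hw).continuous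
  have hwc : Continuous w := hw.continuous
  set ψ : Euc n → ℝ := fun y => F (t ^ 2 + ‖y - x‖ ^ 2) with hψ
  have hF0 : ∀ s, 3 ≤ s → F s = 0 := fun s hs => by simp [hFdef, lineCutoff_eq_zero hs]
  have hψs : ContDiff ℝ (⊤ : ℕ∞) ψ := contDiff_radial he hF x
  have hψc : HasCompactSupport ψ := hasCompactSupport_radial he hF0 x
  have hLψ : ∀ y, negLaplacianPow k ψ y = (radialOp n (t ^ 2))^[k] F (t ^ 2 + ‖y - x‖ ^ 2) :=
    fun y => by rw [hψ, negLaplacianPow_radial he k hF x]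
  have hspos : ∀ y, 0 < t ^ 2 + ‖y - x‖ ^ 2 := fun y => by positivity
  have hin : ∀ y, t ^ 2 + ‖y - x‖ ^ 2 < 2 → negLaplacianPow k ψ y =
      c₀ * (t ^ 2) ^ k * (t ^ 2 + ‖y - x‖ ^ 2) ^ (-((n : ℝ) / 2 + k)) := by
    intro y hy
    rw [hLψ, iterate_radialOp_congr (U := Ioo 0 2) isOpen_Ioo (G := fun s => s ^ (-a))
      (fun s hs => by simp [hFdef, lineCutoff_eq_one hs.2.le]) k ⟨hspos y, hy⟩,
      iterate_radialOp_rpow_critical n k _ (hspos y)]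
  have hout : ∀ y, 3 < t ^ 2 + ‖y - x‖ ^ 2 → negLaplacianPow k ψ y = 0 := by
    intro y hy
    rw [hLψ, iterate_radialOp_congr isOpen_Ioi (G := fun _ => 0)
      (fun s hs => hF0 s (le_of_lt hs)) k (show t ^ 2 + ‖y - x‖ ^ 2 ∈ Ioi 3 from hy),
      iterate_radialOp_zero]
  have hint : ∀ r, IntegrableOn w (closedBall x r) := fun r =>
    hwc.continuousOn.integrableOn_compact (isCompact_closedBall x r)
  -- Where `s < 2` the image of `ψ` is positive and may be dropped outside `B_t(x)`; where `2 ≤ s ≤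
  -- 3` the cutoff costs at most `C`, uniformly in `t`; beyond that it is zero.
  have hbd : ∀ y, (closedBall x t).indicator
        (fun y => c₀ * 2 ^ (-((n : ℝ) / 2 + k)) * t ^ (-(n : ℝ)) * w y) y -
      (closedBall x 2).indicator (fun y => C * w y) y ≤ w y * negLaplacianPow k ψ y := by
    intro y
    have hI2 : 0 ≤ (closedBall x 2).indicator (fun y => C * w y) y :=
      indicator_nonneg (fun y _ => mul_nonneg hC0 (hw0 y)) y
    by_cases h2 : t ^ 2 + ‖y - x‖ ^ 2 < 2
    · have hpos : 0 ≤ w y * negLaplacianPow k ψ y := by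
        rw [hin y h2]
        have := Real.rpow_nonneg (hspos y).le (-((n : ℝ) / 2 + k))
        have := hw0 y
        positivity
      by_cases hy : y ∈ closedBall x t
      · rw [indicator_of_mem hy, hin y h2]
        have hy' : ‖y - x‖ ^ 2 ≤ t ^ 2 := by
          rw [mem_closedBall, dist_eq_norm] at hy
          nlinarith [norm_nonneg (y - x)]
        have h3 : (2 * t ^ 2) ^ (-((n : ℝ) / 2 + k)) ≤
            (t ^ 2 + ‖y - x‖ ^ 2) ^ (-((n : ℝ) / 2 + k)) :=
          Real.rpow_le_rpow_of_nonpos (hspos y) (by linarith)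
            (by have : (0 : ℝ) ≤ n := Nat.cast_nonneg n
                have : (0 : ℝ) ≤ k := Nat.cast_nonneg k
                linarith)
        have h4 : (t ^ 2) ^ k * (2 * t ^ 2) ^ (-((n : ℝ) / 2 + k)) =
            2 ^ (-((n : ℝ) / 2 + k)) * t ^ (-(n : ℝ)) := by
          rw [Real.mul_rpow (by norm_num) he.le, ← Real.rpow_natCast (t ^ 2) k,
            mul_left_comm, ← Real.rpow_add he, ← Real.rpow_natCast t 2, ← Real.rpow_mul ht.1.le]
          congr 2
          push_cast; ring
        have h5 : c₀ * 2 ^ (-((n : ℝ) / 2 + k)) * t ^ (-(n : ℝ)) ≤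
            c₀ * (t ^ 2) ^ k * (t ^ 2 + ‖y - x‖ ^ 2) ^ (-((n : ℝ) / 2 + k)) := by
          calc _ = c₀ * ((t ^ 2) ^ k * (2 * t ^ 2) ^ (-((n : ℝ) / 2 + k))) := by rw [h4]; ring
            _ ≤ c₀ * ((t ^ 2) ^ k * (t ^ 2 + ‖y - x‖ ^ 2) ^ (-((n : ℝ) / 2 + k))) :=
              mul_le_mul_of_nonneg_left (mul_le_mul_of_nonneg_left h3 (by positivity)) hc₀pos.le
            _ = _ := by ring
        have := mul_le_mul_of_nonneg_left h5 (hw0 y)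
        linarith
      · rw [indicator_of_notMem hy]
        linarith
    · have hy : y ∉ closedBall x t := by
        intro hy
        rw [mem_closedBall, dist_eq_norm] at hy
        nlinarith [norm_nonneg (y - x)]
      rw [indicator_of_notMem hy, zero_sub]
      by_cases h3 : 3 < t ^ 2 + ‖y - x‖ ^ 2
      · rw [hout y h3, mul_zero]
        linarith
      · have hy2 : y ∈ closedBall x 2 := by
          rw [mem_closedBall, dist_eq_norm]
          nlinarith [norm_nonneg (y - x)]
        rw [indicator_of_mem hy2, hLψ]
        have := neg_le_of_abs_le (hC (t ^ 2) ⟨he.le, he1.le⟩ (t ^ 2 + ‖y - x‖ ^ 2)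
          ⟨by linarith, by linarith⟩)
        nlinarith [hw0 y]
  -- The centre must be excluded: there the real power of `0` has the default value `0` while `ψ` is
  -- positive. A point is a null set because `n > 0`.
  have hker : ∀ y, y ≠ x → g y * ψ y ≤ g y * truncRiesz n k (y - x) := by
    intro y hy
    refine mul_le_mul_of_nonneg_left ?_ (hg y)
    have hpos : 0 < ‖y - x‖ := norm_pos_iff.2 (sub_ne_zero.2 hy)
    by_cases hy2 : ‖y - x‖ ≤ 2
    · rw [truncRiesz, indicator_of_mem (mem_closedBall_zero_iff.2 hy2)]
      calc ψ y ≤ 1 * (t ^ 2 + ‖y - x‖ ^ 2) ^ (-a) :=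
            mul_le_mul_of_nonneg_right (lineCutoff_le_one _) (Real.rpow_nonneg (hspos y).le _)
        _ ≤ (‖y - x‖ ^ 2) ^ (-a) := by
            rw [one_mul]
            exact Real.rpow_le_rpow_of_nonpos (by positivity) (by linarith) (by linarith)
        _ = ‖y - x‖ ^ (-((n : ℝ) - 2 * k)) := by
            rw [← Real.rpow_natCast ‖y - x‖ 2, ← Real.rpow_mul hpos.le]
            congr 1
            rw [hadef]; push_cast; ring
    · have : ψ y = 0 := hF0 _ (by nlinarith)
      rw [this]
      exact truncRiesz_nonneg n k _
  have hgψ : Integrable fun y => g y * ψ y :=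
    (hgc.mul hψs.continuous).integrable_of_hasCompactSupport hψc.mul_left
  have hψ0 : ∀ y, 0 ≤ ψ y := fun y =>
    mul_nonneg (lineCutoff_nonneg _) (Real.rpow_nonneg (hspos y).le _)
  have h1 : c₀ * 2 ^ (-((n : ℝ) / 2 + k)) * t ^ (-(n : ℝ)) * (∫ y in closedBall x t, w y) -
      C * (∫ y in closedBall x 2, w y) ≤ ∫ y, g y * ψ y := by
    rw [← integral_mul_negLaplacianPow k hw hψs hψc]
    have i1 := (integrable_indicator_iff measurableSet_closedBall).2
      ((hint t).const_mul (c₀ * 2 ^ (-((n : ℝ) / 2 + k)) * t ^ (-(n : ℝ))))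
    have i2 := (integrable_indicator_iff measurableSet_closedBall).2 ((hint 2).const_mul C)
    have := integral_mono (i1.sub i2)
      ((hwc.mul (contDiff_infty_negLaplacianPow k
          hψs).continuous).integrable_of_hasCompactSupport (hψc.negLaplacianPow k).mul_left) hbd
    simp only [Pi.sub_apply] at this
    rwa [integral_sub i1 i2, integral_indicator measurableSet_closedBall,
      integral_indicator measurableSet_closedBall, integral_const_mul, integral_const_mul] at this
  have h2 : ENNReal.ofReal (∫ y, g y * ψ y) ≤
      ∫⁻ y, ENNReal.ofReal (g y * truncRiesz n k (y - x)) := by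
    rw [ofReal_integral_eq_lintegral_ofReal hgψ (ae_of_all _ fun y => mul_nonneg (hg y) (hψ0 y))]
    have : Nonempty (Fin n) := ⟨⟨0, by
      have : (0 : ℝ) < n := by linarith [(Nat.cast_nonneg k : (0 : ℝ) ≤ k)]
      exact_mod_cast this⟩⟩
    refine lintegral_mono_ae ?_
    filter_upwards [compl_mem_ae_iff.2 (measure_singleton x)] with y hy
    exact ENNReal.ofReal_le_ofReal (hker y hy)
  calc _ ≤ ENNReal.ofReal ((∫ y, g y * ψ y) + C * ∫ y in closedBall x 2, w y) :=
        ENNReal.ofReal_le_ofReal (by linarith)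
    _ ≤ _ := ENNReal.ofReal_add_le.trans (add_le_add h2 le_rfl)

/-- Pointwise bound of a nonnegative `w` with `(-Δ)^k w ≥ 0` by a truncated Riesz potential. -/
theorem le_truncated_potential {n k : ℕ} (hkn : (k : ℝ) < n / 2) :
    ∃ c C : ℝ, 0 < c ∧ 0 ≤ C ∧ ∀ w : Euc n → ℝ, ContDiff ℝ ((2 * k : ℕ) : WithTop ℕ∞) w →
      (∀ x, 0 ≤ w x) → (∀ x, 0 ≤ negLaplacianPow k w x) → ∀ x,
      ENNReal.ofReal (c * w x) ≤
        (∫⁻ y, ENNReal.ofReal (negLaplacianPow k w y * truncRiesz n k (y - x))) +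
        ENNReal.ofReal (C * ∫ y in closedBall x 2, w y) := by
  obtain ⟨c, C, hc, hC, h⟩ := setIntegral_closedBall_le_potential hkn
  set ω := volume.real (closedBall (0 : Euc n) 1) with hω
  have hωpos : 0 < ω := ENNReal.toReal_pos (measure_closedBall_pos _ _ one_pos).ne'
    measure_closedBall_lt_top.ne
  refine ⟨c * (ω / 2), C, by positivity, hC, fun w hw hw0 hg x => ?_⟩
  rcases (hw0 x).eq_or_lt with h0 | hpos
  · simp [← h0]
  have hev : ∀ᶠ y in 𝓝 x, w x / 2 < w y :=
    hw.continuous.continuousAt.eventually (lt_mem_nhds (half_lt_self hpos))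
  obtain ⟨r, hr, hball⟩ := Metric.eventually_nhds_iff_ball.1 hev
  set t := min (r / 2) (1 / 2) with ht
  have ht0 : 0 < t := by positivity
  have ht1 : t < 1 := (min_le_right _ _).trans_lt (by norm_num)
  have htr : t < r := (min_le_left _ _).trans_lt (by linarith)
  refine le_trans (ENNReal.ofReal_le_ofReal ?_) (h w hw hw0 hg x t ⟨ht0, ht1⟩)
  have h1 : volume.real (closedBall x t) * (w x / 2) ≤ ∫ y in closedBall x t, w y := by
    have := setIntegral_mono_on (μ := volume) (s := closedBall x t) (f := fun _ => w x / 2) (g := w)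
      (integrableOn_const measure_closedBall_lt_top.ne)
      (hw.continuous.continuousOn.integrableOn_compact (isCompact_closedBall x t))
      measurableSet_closedBall
      (fun y hy => (hball y (closedBall_subset_ball htr hy)).le)
    simpa using this
  rw [Measure.addHaar_real_closedBall' volume x ht0.le, finrank_euclideanSpace_fin, ← hω] at h1
  have h2 : t ^ (-(n : ℝ)) * t ^ n = 1 := by
    rw [← Real.rpow_natCast, ← Real.rpow_add ht0]
    simp
  calc c * (ω / 2) * w x = c * (t ^ (-(n : ℝ)) * t ^ n) * (ω * (w x / 2)) := by rw [h2]; ring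
    _ = c * t ^ (-(n : ℝ)) * (t ^ n * ω * (w x / 2)) := by ring
    _ ≤ _ := mul_le_mul_of_nonneg_left h1 (by positivity)

/-! ### Scaled integrals, nonconcentration, reverse Hölder -/

lemma setIntegral_comp_affine {n : ℕ} (f : Euc n → ℝ) (x : Euc n) {r : ℝ} (hr : 0 < r)
    {S : Set (Euc n)} (hS : MeasurableSet S) :
    ∫ y in (fun y => x + r • y) ⁻¹' S, f (x + r • y) = (r ^ n)⁻¹ * ∫ y in S, f y := by
  have hm : Measurable fun y : Euc n => x + r • y := by fun_prop
  rw [← integral_indicator (hm hS), ← integral_indicator hS]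
  have h1 : ((fun y => x + r • y) ⁻¹' S).indicator (fun y => f (x + r • y)) =
      fun y => (fun z => S.indicator f (x + z)) (r • y) := by
    funext y
    exact indicator_comp_right (s := S) (g := f) (fun y : Euc n => x + r • y)
  rw [h1, Measure.integral_comp_smul, integral_add_left_eq_self (S.indicator f) x,
    finrank_euclideanSpace_fin, smul_eq_mul, abs_of_pos (by positivity)]

lemma preimage_affine_closedBall {n : ℕ} (x z : Euc n) {r : ℝ} (hr : 0 < r) (ρ : ℝ) :
    (fun y => x + r • y) ⁻¹' closedBall (x + r • z) (r * ρ) = closedBall z ρ := by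
  ext y
  rw [mem_preimage, mem_closedBall, mem_closedBall, dist_add_left, dist_smul₀,
    Real.norm_of_nonneg hr.le, mul_le_mul_iff_right₀ hr]

lemma setIntegral_closedBall_comp_affine {n : ℕ} (f : Euc n → ℝ) (x z : Euc n) {r : ℝ}
    (hr : 0 < r) (ρ : ℝ) :
    ∫ y in closedBall z ρ, f (x + r • y) =
      (r ^ n)⁻¹ * ∫ y in closedBall (x + r • z) (r * ρ), f y := by
  rw [← setIntegral_comp_affine f x hr measurableSet_closedBall, preimage_affine_closedBall x z hr]

/-- Uniform integrability of translates of the truncated Riesz kernel. -/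
lemma exists_setLIntegral_truncRiesz_le {n k : ℕ} (hk : 1 ≤ k) (hkn : (k : ℝ) < n / 2) {η : ℝ}
    (hη : 0 < η) : ∃ δ : ℝ, 0 < δ ∧ δ ≤ η ∧ ∀ E : Set (Euc n), MeasurableSet E →
      volume E < ENNReal.ofReal δ → ∀ y,
      ∫⁻ x in E, ENNReal.ofReal (truncRiesz n k (y - x)) ≤ ENNReal.ofReal η := by
  obtain ⟨δ, hδ, h⟩ := exists_pos_setLIntegral_lt_of_measure_lt
    ((integrable_truncRiesz hk hkn).lintegral_lt_top.ne) (ENNReal.ofReal_pos.2 hη).ne'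
  obtain ⟨δ', hδ', hlt⟩ : ∃ δ' : ℝ, 0 < δ' ∧ ENNReal.ofReal δ' ≤ δ := by
    rcases eq_or_ne δ ⊤ with rfl | hne
    · exact ⟨1, one_pos, le_top⟩
    · exact ⟨δ.toReal, ENNReal.toReal_pos hδ.ne' hne, ENNReal.ofReal_toReal_le⟩
  refine ⟨min δ' η, lt_min hδ' hη, min_le_right _ _, fun E hE hvol y => ?_⟩
  have hm : Measurable fun x : Euc n => y - x := by fun_prop
  have e1 : ∫⁻ x in E, ENNReal.ofReal (truncRiesz n k (y - x)) =
      ∫⁻ z in (fun x => y - x) ⁻¹' E, ENNReal.ofReal (truncRiesz n k z) := by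
    rw [← lintegral_indicator hE, ← lintegral_indicator (hm hE),
      ← lintegral_sub_left_eq_self _ y]
    refine lintegral_congr fun x => ?_
    simp only [indicator, sub_sub_cancel]
    rfl
  rw [e1]
  refine (h _ ?_).le
  have : volume ((fun x => y - x) ⁻¹' E) = volume E :=
    (Measure.measurePreserving_sub_left volume y).measure_preimage hE.nullMeasurableSet
  rw [this]
  exact hvol.trans_le ((ENNReal.ofReal_le_ofReal (min_le_left _ _)).trans hlt)

lemma Continuous.integrableOn_closedBall {n : ℕ} {f : Euc n → ℝ} (hf : Continuous f) (x : Euc n)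
    (r : ℝ) : IntegrableOn f (closedBall x r) :=
  hf.continuousOn.integrableOn_compact (isCompact_closedBall x r)

lemma setIntegral_mono_closedBall {n : ℕ} {f : Euc n → ℝ} (hf : Continuous f) (hf0 : ∀ x, 0 ≤ f x)
    {S : Set (Euc n)} {x : Euc n} {r : ℝ} (hS : S ⊆ closedBall x r) :
    ∫ y in S, f y ≤ ∫ y in closedBall x r, f y :=
  setIntegral_mono_set (hf.integrableOn_closedBall x r) (ae_of_all _ hf0) hS.eventuallyLE

/-- The unit-ball estimate applied to `w(R·)`: the operator produces `R^(2k)`, and the Jacobians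
cancel. -/
theorem setIntegral_negLaplacianPow_closedBall_le (n : ℕ) {k : ℕ} (hk : 1 ≤ k) :
    ∃ C : ℝ, 0 ≤ C ∧ ∀ w : Euc n → ℝ, ContDiff ℝ ((2 * k : ℕ) : WithTop ℕ∞) w → (∀ x, 0 ≤ w x) →
      (∀ x, 0 ≤ negLaplacianPow k w x) → ∀ R : ℝ, 0 < R →
      R ^ (2 * k) * ∫ x in closedBall 0 R, negLaplacianPow k w x ≤
        C * ∫ x in closedBall 0 (2 * R) \ ball 0 R, w x := by
  obtain ⟨C, hC, h⟩ := setIntegral_negLaplacianPow_le n hk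
  refine ⟨C, hC, fun w hw hw0 hg R hR => ?_⟩
  have haff : ContDiff ℝ ((2 * k : ℕ) : WithTop ℕ∞) (fun z : Euc n => 1 * w (0 + R • z)) :=
    contDiff_const.mul (hw.comp (contDiff_const.add (contDiff_id.const_smul R)))
  have hL := fun y => negLaplacianPow_comp_affine k w hw 1 R 0 y
  have h1 := h _ haff (fun x => by simpa using hw0 _) (fun x => by
    rw [hL]
    have := hg (0 + R • x)
    positivity)
  simp only [hL] at h1
  have hpre : (fun y : Euc n => 0 + R • y) ⁻¹' (closedBall 0 (2 * R) \ ball 0 R) =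
      closedBall 0 2 \ ball 0 1 := by
    ext y
    simp only [mem_preimage, Set.mem_sdiff, mem_closedBall_zero_iff, mem_ball_zero_iff, zero_add,
      norm_smul, Real.norm_of_nonneg hR.le, not_lt]
    rw [mul_comm 2 R, mul_le_mul_iff_right₀ hR, le_mul_iff_one_le_right hR]
  rw [integral_const_mul, integral_const_mul, setIntegral_closedBall_comp_affine _ _ _ hR, ← hpre,
    setIntegral_comp_affine w 0 hR (measurableSet_closedBall.diff measurableSet_ball)] at h1
  simp only [smul_zero, add_zero, mul_one, one_mul] at h1
  have hRn : 0 < (R ^ n)⁻¹ := by positivity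
  rw [mul_left_comm, mul_left_comm C] at h1
  exact le_of_mul_le_mul_left h1 hRn

/-- Nonconcentration: the mass of `w` on small sets is a small fraction of its local mass. -/
theorem exists_setIntegral_le_of_volume_lt {n k : ℕ} (hk : 1 ≤ k) (hkn : (k : ℝ) < n / 2) {η : ℝ}
    (hη : 0 < η) : ∃ δ : ℝ, 0 < δ ∧ ∀ w : Euc n → ℝ, ContDiff ℝ ((2 * k : ℕ) : WithTop ℕ∞) w →
      (∀ x, 0 ≤ w x) → (∀ x, 0 ≤ negLaplacianPow k w x) →
      ∀ E : Set (Euc n), MeasurableSet E → E ⊆ closedBall 0 1 → volume E < ENNReal.ofReal δ →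
      ∫ x in E, w x ≤ η * ∫ x in closedBall 0 6, w x := by
  obtain ⟨c, C, hc, hC, hpot⟩ := le_truncated_potential hkn
  obtain ⟨C', hC', hcut⟩ := setIntegral_negLaplacianPow_closedBall_le n hk
  -- Chosen so that `η'(C' + C) ≤ ηc`: the potential term costs `η'C'` and the local mass term
  -- `η'C`, the latter because `δ ≤ η'` bounds the volume of `E`.
  have hη' : 0 < η * c / (C' + C + 1) := by positivity
  set η' := η * c / (C' + C + 1) with hη'def
  obtain ⟨δ, hδ, hδη, hker⟩ := exists_setLIntegral_truncRiesz_le hk hkn hη'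
  refine ⟨δ, hδ, fun w hw hw0 hg E hE hE1 hvol => ?_⟩
  have hwc := hw.continuous
  set g := negLaplacianPow k w with hgdef
  have hgc : Continuous g := (contDiff_negLaplacianPow k 0 hw).continuous
  set W := ∫ x in closedBall 0 6, w x with hW
  have hW0 : 0 ≤ W := integral_nonneg hw0
  -- For `x` in the unit ball the kernel of range `2` reaches only the ball of radius `3`; the
  -- cutoff estimate doubles this to `6`.
  have hg3 : ∫ x in closedBall 0 3, g x ≤ C' * W := by
    have h1 := hcut w hw hw0 hg 3 (by norm_num)
    have h2 : ∫ x in closedBall (0 : Euc n) (2 * 3) \ ball 0 3, w x ≤ W := by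
      rw [hW]
      refine setIntegral_mono_closedBall hwc hw0 ?_
      rw [show (2 * 3 : ℝ) = 6 by norm_num]
      exact sdiff_subset
    have h3 : (1 : ℝ) ≤ 3 ^ (2 * k) := one_le_pow₀ (by norm_num)
    have h4 : 0 ≤ ∫ x in closedBall (0 : Euc n) 3, g x := integral_nonneg hg
    nlinarith [mul_le_mul_of_nonneg_left h2 hC']
  have hK := measurable_truncRiesz n k
  have hpt : ∀ x ∈ E, ENNReal.ofReal (c * w x) ≤
      (∫⁻ y in closedBall 0 3, ENNReal.ofReal (g y) * ENNReal.ofReal (truncRiesz n k (y - x))) +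
      ENNReal.ofReal (C * W) := by
    intro x hx
    have hx1 := mem_closedBall_zero_iff.1 (hE1 hx)
    refine (hpot w hw hw0 hg x).trans (add_le_add ?_ (ENNReal.ofReal_le_ofReal ?_))
    · rw [← lintegral_indicator measurableSet_closedBall]
      refine lintegral_mono fun y => ?_
      by_cases hy : y ∈ closedBall (0 : Euc n) 3
      · rw [indicator_of_mem hy, ENNReal.ofReal_mul (hg y)]
      · have : truncRiesz n k (y - x) = 0 := by
          refine indicator_of_notMem (fun h => hy ?_) _
          rw [mem_closedBall_zero_iff] at h ⊢
          calc ‖y‖ = ‖(y - x) + x‖ := by rw [sub_add_cancel]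
            _ ≤ 3 := (norm_add_le _ _).trans (by linarith)
        rw [this]; simp
    · refine mul_le_mul_of_nonneg_left (setIntegral_mono_closedBall hwc hw0 ?_) hC
      refine closedBall_subset_closedBall' ?_
      rw [dist_zero_right]; linarith
  have hmeas : AEMeasurable (Function.uncurry fun (x y : Euc n) =>
      ENNReal.ofReal (g y) * ENNReal.ofReal (truncRiesz n k (y - x)))
      ((volume.restrict E).prod (volume.restrict (closedBall 0 3))) := by
    refine Measurable.aemeasurable ?_
    have h1 : Measurable fun p : Euc n × Euc n => g p.2 := hgc.measurable.comp measurable_snd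
    have h2 : Measurable fun p : Euc n × Euc n => truncRiesz n k (p.2 - p.1) :=
      hK.comp (measurable_snd.sub measurable_fst)
    exact h1.ennreal_ofReal.mul h2.ennreal_ofReal
  -- Tonelli puts the integral over `E` on the kernel, where it is at most `η'` uniformly in `y`.
  have hI : ∫⁻ x in E, ENNReal.ofReal (c * w x) ≤ ENNReal.ofReal (η' * (C' + C) * W) := by
    calc ∫⁻ x in E, ENNReal.ofReal (c * w x)
        ≤ ∫⁻ x in E, ((∫⁻ y in closedBall 0 3, ENNReal.ofReal (g y) *
            ENNReal.ofReal (truncRiesz n k (y - x))) + ENNReal.ofReal (C * W)) :=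
          setLIntegral_mono' hE hpt
      _ = (∫⁻ x in E, ∫⁻ y in closedBall 0 3, ENNReal.ofReal (g y) *
            ENNReal.ofReal (truncRiesz n k (y - x))) + ENNReal.ofReal (C * W) * volume E := by
          rw [lintegral_add_right _ measurable_const, setLIntegral_const]
      _ = (∫⁻ y in closedBall 0 3, ∫⁻ x in E, ENNReal.ofReal (g y) *
            ENNReal.ofReal (truncRiesz n k (y - x))) + ENNReal.ofReal (C * W) * volume E := by
          rw [lintegral_lintegral_swap hmeas]
      _ ≤ (∫⁻ y in closedBall 0 3, ENNReal.ofReal (g y) * ENNReal.ofReal η') +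
            ENNReal.ofReal (C * W) * ENNReal.ofReal η' := by
          refine add_le_add (lintegral_mono fun y => ?_) ?_
          · rw [lintegral_const_mul' _ _ ENNReal.ofReal_ne_top]
            gcongr
            exact hker E hE hvol y
          · gcongr
            exact hvol.le.trans (ENNReal.ofReal_le_ofReal hδη)
      _ = ENNReal.ofReal (∫ y in closedBall 0 3, g y) * ENNReal.ofReal η' +
            ENNReal.ofReal (C * W) * ENNReal.ofReal η' := by
          rw [lintegral_mul_const' _ _ ENNReal.ofReal_ne_top,
            ofReal_integral_eq_lintegral_ofReal (hgc.integrableOn_closedBall 0 3) (ae_of_all _ hg)]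
      _ ≤ ENNReal.ofReal (C' * W) * ENNReal.ofReal η' +
            ENNReal.ofReal (C * W) * ENNReal.ofReal η' := by gcongr
      _ = ENNReal.ofReal (η' * (C' + C) * W) := by
          rw [← ENNReal.ofReal_mul (by positivity), ← ENNReal.ofReal_mul (by positivity),
            ← ENNReal.ofReal_add (by positivity) (by positivity)]
          congr 1; ring
  have hwE : IntegrableOn w E := (hwc.integrableOn_closedBall 0 1).mono_set hE1
  rw [← ofReal_integral_eq_lintegral_ofReal (hwE.const_mul c)
    (ae_of_all _ fun x => mul_nonneg hc.le (hw0 x)), integral_const_mul,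
    ENNReal.ofReal_le_ofReal_iff (by positivity)] at hI
  have h5 : η' * (C' + C) ≤ η * c := by
    rw [hη'def, div_mul_eq_mul_div, div_le_iff₀ (by positivity)]
    nlinarith [mul_pos hη hc]
  have h6 : c * ∫ x in E, w x ≤ c * (η * W) := by
    calc _ ≤ η' * (C' + C) * W := hI
      _ ≤ η * c * W := mul_le_mul_of_nonneg_right h5 hW0
      _ = _ := by ring
  exact le_of_mul_le_mul_left h6 hc

/-- Interpolated reverse Hölder inequality. -/
theorem setIntegral_le_add_rpow {n k : ℕ} (hk : 1 ≤ k) (hkn : (k : ℝ) < n / 2) {η q : ℝ}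
    (hη : 0 < η) (hq : 0 < q) : ∃ C : ℝ, 0 ≤ C ∧ ∀ w : Euc n → ℝ,
      ContDiff ℝ ((2 * k : ℕ) : WithTop ℕ∞) w →
      (∀ x, 0 < w x) → (∀ x, 0 ≤ negLaplacianPow k w x) →
      ∫ x in closedBall 0 1, w x ≤ η * (∫ x in closedBall 0 6, w x) +
        C * (∫ x in closedBall 0 1, w x ^ q) ^ (1 / q) := by
  obtain ⟨δ, hδ, h⟩ := exists_setIntegral_le_of_volume_lt hk hkn hη
  set ω := volume.real (closedBall (0 : Euc n) 1) with hω
  have hω0 : 0 < ω := ENNReal.toReal_pos (measure_closedBall_pos _ _ one_pos).ne'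
    measure_closedBall_lt_top.ne
  refine ⟨(2 / δ) ^ (1 / q) * ω, by positivity, fun w hw hw0 hg => ?_⟩
  have hwc := hw.continuous
  have hwqc : Continuous fun x => w x ^ q := hwc.rpow_const fun x => Or.inl (hw0 x).ne'
  set Q := ∫ x in closedBall 0 1, w x ^ q with hQ
  have hQpos : 0 < Q := by
    rw [hQ, setIntegral_pos_iff_support_of_nonneg_ae
      (ae_of_all _ fun x => (Real.rpow_pos_of_pos (hw0 x) q).le) (hwqc.integrableOn_closedBall 0 1)]
    have : Function.support (fun x => w x ^ q) = univ :=
      eq_univ_of_forall fun x => (Real.rpow_pos_of_pos (hw0 x) q).ne'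
    rw [this, univ_inter]
    exact measure_closedBall_pos _ _ one_pos
  -- With `λ^q = 2Q/δ`, Chebyshev gives the set `w > λ` volume at most `δ/2`. Nonconcentration
  -- controls that set, and `w ≤ λ` controls the rest.
  set lam := (2 / δ * Q) ^ (1 / q) with hlam
  have hlam0 : 0 < lam := by positivity
  have hlamq : lam ^ q = 2 / δ * Q := by
    rw [hlam, ← Real.rpow_mul (by positivity), one_div_mul_cancel hq.ne', Real.rpow_one]
  set E := closedBall (0 : Euc n) 1 ∩ {x | lam < w x} with hE
  have hEm : MeasurableSet {x | lam < w x} := measurableSet_lt measurable_const hwc.measurable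
  have hEm' : MeasurableSet E := measurableSet_closedBall.inter hEm
  have hfin : volume E ≠ ⊤ :=
    ((measure_mono inter_subset_left).trans_lt measure_closedBall_lt_top).ne
  have hvol : volume E < ENNReal.ofReal δ := by
    have h1 : volume.real E * (2 / δ * Q) ≤ Q := by
      have h2 := setIntegral_mono_on (μ := volume) (s := E) (f := fun _ => 2 / δ * Q)
        (g := fun x => w x ^ q) (integrableOn_const hfin)
        ((hwqc.integrableOn_closedBall 0 1).mono_set inter_subset_left) hEm' (fun x hx => by
          rw [← hlamq]
          exact Real.rpow_le_rpow hlam0.le (le_of_lt hx.2) hq.le)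
      have h3 : ∫ x in E, w x ^ q ≤ Q := setIntegral_mono_closedBall hwqc
        (fun x => (Real.rpow_pos_of_pos (hw0 x) q).le) inter_subset_left
      simp only [setIntegral_const, smul_eq_mul] at h2
      exact h2.trans h3
    rw [← ENNReal.ofReal_toReal hfin, ENNReal.ofReal_lt_ofReal_iff hδ]
    change volume.real E < δ
    have h4 : volume.real E * (2 / δ) ≤ 1 := by
      rw [← mul_assoc] at h1
      exact le_of_mul_le_mul_right (by linarith) hQpos
    rw [mul_div_assoc', div_le_one hδ] at h4
    linarith
  have hsplit := integral_inter_add_sdiff (s := closedBall (0 : Euc n) 1) hEm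
    (hwc.integrableOn_closedBall 0 1)
  have hA := h w hw (fun x => (hw0 x).le) hg E hEm' inter_subset_left hvol
  have hB : ∫ x in closedBall 0 1 \ {x | lam < w x}, w x ≤ (2 / δ) ^ (1 / q) * ω * Q ^ (1 / q) := by
    have hfin' : volume (closedBall (0 : Euc n) 1 \ {x | lam < w x}) ≠ ⊤ :=
      ((measure_mono sdiff_subset).trans_lt measure_closedBall_lt_top).ne
    have h2 := setIntegral_mono_on (μ := volume) (s := closedBall (0 : Euc n) 1 \ {x | lam < w x})
      (f := w) (g := fun _ => lam)
      ((hwc.integrableOn_closedBall 0 1).mono_set sdiff_subset) (integrableOn_const hfin')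
      (measurableSet_closedBall.diff hEm) (fun x hx => not_lt.1 hx.2)
    simp only [setIntegral_const, smul_eq_mul] at h2
    refine h2.trans ?_
    have h3 : volume.real (closedBall (0 : Euc n) 1 \ {x | lam < w x}) ≤ ω :=
      measureReal_mono sdiff_subset measure_closedBall_lt_top.ne
    calc _ ≤ ω * lam := mul_le_mul_of_nonneg_right h3 hlam0.le
      _ = _ := by rw [hlam, Real.mul_rpow (by positivity) hQpos.le]; ring
  rw [← hsplit]
  exact add_le_add hA hB

/-! ### Supersolutions: scaling and the coupled estimate -/

/-- Positive supersolutions of the system with lower coefficient `c`. -/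
structure IsSupersolution {n : ℕ} (k : ℕ) (p q c : ℝ) (u v : Euc n → ℝ) : Prop where
  contDiff_fst : ContDiff ℝ ((2 * k : ℕ) : WithTop ℕ∞) u
  contDiff_snd : ContDiff ℝ ((2 * k : ℕ) : WithTop ℕ∞) v
  pos_fst : ∀ x, 0 < u x
  pos_snd : ∀ x, 0 < v x
  le_fst : ∀ x, c * v x ^ q ≤ negLaplacianPow k u x
  le_snd : ∀ x, c * u x ^ p ≤ negLaplacianPow k v x

lemma IsSupersolution.symm {n k : ℕ} {p q c : ℝ} {u v : Euc n → ℝ}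
    (h : IsSupersolution k p q c u v) : IsSupersolution k q p c v u :=
  ⟨h.contDiff_snd, h.contDiff_fst, h.pos_snd, h.pos_fst, h.le_snd, h.le_fst⟩

lemma IsSupersolution.negLaplacianPow_nonneg {n k : ℕ} {p q c : ℝ} (hc : 0 < c) {u v : Euc n → ℝ}
    (h : IsSupersolution k p q c u v) (x : Euc n) : 0 ≤ negLaplacianPow k u x :=
  le_trans (mul_nonneg hc.le (Real.rpow_nonneg (h.pos_snd x).le q)) (h.le_fst x)

/-- The rescaling `y ↦ r^α u(x + r y)`. -/
noncomputable def rescale {n : ℕ} (α : ℝ) (x : Euc n) (r : ℝ) (u : Euc n → ℝ) (y : Euc n) : ℝ :=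
  r ^ α * u (x + r • y)

lemma rescale_rescale {n : ℕ} (α : ℝ) (x z : Euc n) {r s : ℝ} (hr : 0 < r) (hs : 0 < s)
    (u : Euc n → ℝ) :
    rescale α z s (rescale α x r u) = rescale α (x + r • z) (r * s) u := by
  funext y
  simp only [rescale]
  rw [Real.mul_rpow hr.le hs.le, smul_add, smul_smul, ← add_assoc]
  ring

lemma rescale_zero_one {n : ℕ} (α : ℝ) (u : Euc n → ℝ) : rescale α 0 1 u = u := by
  funext y; simp [rescale]

lemma Continuous.rescale {n : ℕ} {u : Euc n → ℝ} (hu : Continuous u) (α : ℝ) (x : Euc n) (r : ℝ) :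
    Continuous (rescale α x r u) :=
  continuous_const.mul (hu.comp (by fun_prop))

/-- Both sides acquire the same power of `r` exactly when `α + 2k = βq` and `β + 2k = αp`, so `c` is
unchanged and every later bound holds at all centres and scales. -/
lemma IsSupersolution.rescale {n k : ℕ} {p q c α β : ℝ} (hα : α + 2 * k = β * q)
    (hβ : β + 2 * k = α * p) {u v : Euc n → ℝ} (h : IsSupersolution k p q c u v) (x : Euc n) {r : ℝ}
    (hr : 0 < r) : IsSupersolution k p q c (rescale α x r u) (rescale β x r v) := by
  have key : ∀ {a b s : ℝ} {f g : Euc n → ℝ}, a + 2 * k = b * s →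
      ContDiff ℝ ((2 * k : ℕ) : WithTop ℕ∞) f → (∀ x, 0 < g x) →
      (∀ x, c * g x ^ s ≤ negLaplacianPow k f x) → ∀ y,
      c * _root_.rescale b x r g y ^ s ≤ negLaplacianPow k (_root_.rescale a x r f) y := by
    intro a b s f g hab hf hg hfg y
    have e1 : negLaplacianPow k (_root_.rescale a x r f) y =
        r ^ a * r ^ (2 * k) * negLaplacianPow k f (x + r • y) :=
      negLaplacianPow_comp_affine k f hf (r ^ a) r x y
    have e2 : _root_.rescale b x r g y ^ s = r ^ a * r ^ (2 * k) * g (x + r • y) ^ s := by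
      rw [_root_.rescale, Real.mul_rpow (Real.rpow_nonneg hr.le _) (hg _).le, ← Real.rpow_mul hr.le,
        ← hab, Real.rpow_add hr]
      congr 2
      rw [← Real.rpow_natCast]; push_cast; rfl
    rw [e1, e2, mul_left_comm]
    exact mul_le_mul_of_nonneg_left (hfg _) (by positivity)
  have hsm : ∀ {a : ℝ} {f : Euc n → ℝ}, ContDiff ℝ ((2 * k : ℕ) : WithTop ℕ∞) f →
      ContDiff ℝ ((2 * k : ℕ) : WithTop ℕ∞) (_root_.rescale a x r f) := fun hf =>
    contDiff_const.mul (hf.comp (contDiff_const.add (contDiff_id.const_smul r)))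
  exact ⟨hsm h.contDiff_fst, hsm h.contDiff_snd,
    fun y => mul_pos (Real.rpow_pos_of_pos hr _) (h.pos_fst _),
    fun y => mul_pos (Real.rpow_pos_of_pos hr _) (h.pos_snd _),
    key hα h.contDiff_fst h.pos_snd h.le_fst, key hβ h.contDiff_snd h.pos_fst h.le_snd⟩

lemma setIntegral_closedBall_eq_rescale {n : ℕ} (α : ℝ) (u : Euc n → ℝ) (z : Euc n) {ρ : ℝ}
    (hρ : 0 < ρ) : ∫ y in closedBall z ρ, u y =
      ρ ^ n * ρ ^ (-α) * ∫ y in closedBall 0 1, rescale α z ρ u y := by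
  have h := setIntegral_closedBall_comp_affine u z 0 hρ 1
  simp only [smul_zero, add_zero, mul_one] at h
  simp only [rescale]
  rw [integral_const_mul, h]
  have h1 : ρ ^ (-α) * ρ ^ α = 1 := by rw [← Real.rpow_add hρ]; simp
  have h2 : ρ ^ n * (ρ ^ n)⁻¹ = 1 := mul_inv_cancel₀ (by positivity)
  linear_combination (-(ρ ^ (-α) * ρ ^ α * ∫ y in closedBall z ρ, u y)) * h2 -
    (∫ y in closedBall z ρ, u y) * h1

/-- Covering a compact set by small balls. -/
lemma exists_cover_setIntegral_le {n : ℕ} {S : Set (Euc n)} (hS : IsCompact S) {ρ : ℝ}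
    (hρ : 0 < ρ) : ∃ I : Finset (Euc n), (∀ z ∈ I, z ∈ S) ∧ ∀ f : Euc n → ℝ, Continuous f →
      (∀ x, 0 ≤ f x) → ∫ x in S, f x ≤ ∑ z ∈ I, ∫ x in closedBall z ρ, f x := by
  obtain ⟨t, htS, htf, hcov⟩ := hS.finite_cover_balls hρ
  refine ⟨htf.toFinset, fun z hz => htS (htf.mem_toFinset.1 hz), fun f hf hf0 => ?_⟩
  simp_rw [← integral_indicator measurableSet_closedBall]
  rw [← integral_indicator hS.measurableSet, ← integral_finsetSum]
  · refine integral_mono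
      ((integrable_indicator_iff hS.measurableSet).2 (hf.continuousOn.integrableOn_compact hS))
      (integrable_finsetSum _ fun z _ => (integrable_indicator_iff measurableSet_closedBall).2
        (hf.integrableOn_closedBall z ρ)) fun x => ?_
    have hnn : ∀ z ∈ htf.toFinset, 0 ≤ (closedBall z ρ).indicator f x := fun z _ =>
      indicator_nonneg (fun y _ => hf0 y) x
    by_cases hx : x ∈ S
    · obtain ⟨z, hz, hxz⟩ := mem_iUnion₂.1 (hcov hx)
      rw [indicator_of_mem hx]
      refine le_trans (le_of_eq ?_) (Finset.single_le_sum hnn (htf.mem_toFinset.2 hz))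
      rw [indicator_of_mem (ball_subset_closedBall hxz)]
    · rw [indicator_of_notMem hx]
      exact Finset.sum_nonneg hnn
  · exact fun z _ => (integrable_indicator_iff measurableSet_closedBall).2
      (hf.integrableOn_closedBall z ρ)

/-- The cutoff estimate for `v`, with `c u^p ≤ (-Δ)^k v`. Keeping the annulus, rather than the full
ball, is what the critical case of the Liouville theorem needs. -/
lemma IsSupersolution.setIntegral_rpow_le (n : ℕ) {k : ℕ} (hk : 1 ≤ k) {c : ℝ} (hc : 0 < c) :
    ∃ C : ℝ, 0 ≤ C ∧ ∀ (p q : ℝ) (u v : Euc n → ℝ), IsSupersolution k p q c u v →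
      ∫ x in closedBall 0 1, u x ^ p ≤ C * ∫ x in closedBall 0 2 \ ball 0 1, v x := by
  obtain ⟨C, hC, h⟩ := setIntegral_negLaplacianPow_le n hk
  refine ⟨c⁻¹ * C, by positivity, fun p q u v huv => ?_⟩
  have h1 := h v huv.contDiff_snd (fun x => (huv.pos_snd x).le)
    (huv.symm.negLaplacianPow_nonneg hc)
  have hup : Continuous fun x => u x ^ p :=
    huv.contDiff_fst.continuous.rpow_const fun x => Or.inl (huv.pos_fst x).ne'
  have hg : Continuous (negLaplacianPow k v) :=
    (contDiff_negLaplacianPow k 0 huv.contDiff_snd).continuous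
  have h2 : c * ∫ x in closedBall 0 1, u x ^ p ≤ ∫ x in closedBall 0 1, negLaplacianPow k v x := by
    rw [← integral_const_mul]
    exact setIntegral_mono ((hup.integrableOn_closedBall 0 1).const_mul c)
      (hg.integrableOn_closedBall 0 1) huv.le_snd
  rw [mul_assoc, ← div_eq_inv_mul, le_div_iff₀ hc, mul_comm]
  exact h2.trans h1

/-- The basic coupled estimate. -/
lemma IsSupersolution.setIntegral_fst_le {n k : ℕ} (hk : 1 ≤ k) (hkn : (k : ℝ) < n / 2)
    {c p η : ℝ} (hc : 0 < c) (hp : 0 < p) (hη : 0 < η) :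
    ∃ C : ℝ, 0 ≤ C ∧ ∀ (q : ℝ) (u v : Euc n → ℝ), IsSupersolution k p q c u v →
      ∫ x in closedBall 0 1, u x ≤ η * (∫ x in closedBall 0 6, u x) +
        C * (∫ x in closedBall 0 6, v x) ^ (1 / p) := by
  obtain ⟨C₁, hC₁, h₁⟩ := setIntegral_le_add_rpow hk hkn hη hp
  obtain ⟨C₂, hC₂, h₂⟩ := IsSupersolution.setIntegral_rpow_le n hk hc
  refine ⟨C₁ * C₂ ^ (1 / p), by positivity, fun q u v huv => ?_⟩
  have hvc := huv.contDiff_snd.continuous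
  have hv0 : ∀ x, 0 ≤ v x := fun x => (huv.pos_snd x).le
  have h3 := h₁ u huv.contDiff_fst huv.pos_fst (huv.negLaplacianPow_nonneg hc)
  have h4 : ∫ x in closedBall 0 1, u x ^ p ≤ C₂ * ∫ x in closedBall 0 6, v x :=
    (h₂ p q u v huv).trans (mul_le_mul_of_nonneg_left (setIntegral_mono_closedBall hvc hv0
      (sdiff_subset.trans (closedBall_subset_closedBall (by norm_num)))) hC₂)
  have h5 : (∫ x in closedBall 0 1, u x ^ p) ^ (1 / p) ≤
      C₂ ^ (1 / p) * (∫ x in closedBall 0 6, v x) ^ (1 / p) := by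
    rw [← Real.mul_rpow hC₂ (integral_nonneg hv0)]
    exact Real.rpow_le_rpow (integral_nonneg fun x => Real.rpow_nonneg (huv.pos_fst x).le _) h4
      (by positivity)
  rw [mul_assoc]
  exact h3.trans (by gcongr)

/-! ### Universal mass bound -/

lemma le_rpow_of_le_mul_rpow {X A θ : ℝ} (hX : 0 ≤ X) (hA : 0 ≤ A) (hθ : θ < 1)
    (h : X ≤ A * X ^ θ) : X ≤ A ^ (1 / (1 - θ)) := by
  rcases hX.eq_or_lt with h0 | hpos
  · rw [← h0]; exact Real.rpow_nonneg hA _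
  · have hd : 0 < 1 - θ := by linarith
    have h1 : X ^ (1 - θ) ≤ A := by
      rw [Real.rpow_sub hpos, Real.rpow_one, div_le_iff₀ (Real.rpow_pos_of_pos hpos θ)]
      exact h
    calc X = (X ^ (1 - θ)) ^ (1 / (1 - θ)) := by
          rw [← Real.rpow_mul hpos.le, mul_one_div_cancel hd.ne', Real.rpow_one]
      _ ≤ _ := Real.rpow_le_rpow (Real.rpow_nonneg hpos.le _) h1 (by positivity)

/-- Centres and radii of balls well inside the unit ball. -/
def interiorBalls (n : ℕ) : Set (Euc n × ℝ) := {z | 0 < z.2 ∧ ‖z.1‖ + 12 * z.2 ≤ 1}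

/-- The supremum of the rescaled masses over interior balls. -/
noncomputable def massSup {n : ℕ} (α : ℝ) (u : Euc n → ℝ) : ℝ :=
  sSup ((fun z : Euc n × ℝ => ∫ y in closedBall 0 1, rescale α z.1 z.2 u y) '' interiorBalls n)

/-- Interior balls stay in the unit ball, where `u` is bounded, and `r^α ≤ 1` since `α ≥ 0`.
Finiteness of the supremum is what makes absorption legitimate. -/
lemma bddAbove_masses {n : ℕ} {α : ℝ} (hα : 0 ≤ α) {u : Euc n → ℝ} (hu : Continuous u)
    (hu0 : ∀ x, 0 ≤ u x) :
    BddAbove ((fun z : Euc n × ℝ => ∫ y in closedBall 0 1, rescale α z.1 z.2 u y) ''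
      interiorBalls n) := by
  obtain ⟨B, hB⟩ := (isCompact_closedBall (0 : Euc n) 1).exists_bound_of_continuousOn
    hu.continuousOn
  refine ⟨∫ _ in closedBall (0 : Euc n) 1, B, ?_⟩
  rintro _ ⟨⟨x, r⟩, ⟨hr, hxr⟩, rfl⟩
  simp only at hr hxr
  refine setIntegral_mono_on ((hu.rescale α x r).integrableOn_closedBall 0 1)
    (integrableOn_const measure_closedBall_lt_top.ne) measurableSet_closedBall fun y hy => ?_
  have hy1 := mem_closedBall_zero_iff.1 hy
  have h1 : u (x + r • y) ≤ B := by
    refine (le_abs_self _).trans (hB _ (mem_closedBall_zero_iff.2 ?_))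
    calc ‖x + r • y‖ ≤ ‖x‖ + r * ‖y‖ := by
          refine (norm_add_le _ _).trans ?_
          rw [norm_smul, Real.norm_of_nonneg hr.le]
      _ ≤ 1 := by nlinarith
  have h2 : r ^ α ≤ 1 := Real.rpow_le_one hr.le (by linarith [norm_nonneg x]) hα
  calc r ^ α * u (x + r • y) ≤ 1 * u (x + r • y) := mul_le_mul_of_nonneg_right h2 (hu0 _)
    _ ≤ B := by rwa [one_mul]

lemma massSup_nonneg {n : ℕ} (α : ℝ) {u : Euc n → ℝ} (hu0 : ∀ x, 0 ≤ u x) : 0 ≤ massSup α u := by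
  refine Real.sSup_nonneg ?_
  rintro _ ⟨⟨x, r⟩, ⟨hr, -⟩, rfl⟩
  exact integral_nonneg fun y => mul_nonneg (Real.rpow_nonneg (le_of_lt hr) _) (hu0 _)

/-- Mass on a larger ball is controlled by the supremum over smaller interior balls. -/
lemma exists_setIntegral_rescale_le_massSup (n : ℕ) {α : ℝ} (hα : 0 ≤ α) :
    ∃ M : ℝ, 0 < M ∧ ∀ u : Euc n → ℝ, Continuous u → (∀ x, 0 ≤ u x) → ∀ z ∈ interiorBalls n,
      ∫ y in closedBall 0 6, rescale α z.1 z.2 u y ≤ M * massSup α u := by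
  obtain ⟨I, hI, hcov⟩ := exists_cover_setIntegral_le (isCompact_closedBall (0 : Euc n) 6)
    (ρ := 1 / 2) (by norm_num)
  set m : ℝ := (1 / 2) ^ n * (1 / 2) ^ (-α) with hm
  have hm0 : 0 < m := by positivity
  refine ⟨I.card * m + 1, by positivity, fun u hu hu0 z hz => ?_⟩
  obtain ⟨x, r⟩ := z
  obtain ⟨hr, hxr⟩ := hz
  simp only at hr hxr ⊢
  have h1 := hcov (rescale α x r u) (hu.rescale α x r)
    (fun y => mul_nonneg (Real.rpow_nonneg hr.le _) (hu0 _))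
  have h2 : ∀ i ∈ I, ∫ y in closedBall i (1 / 2), rescale α x r u y ≤ m * massSup α u := by
    intro i hi
    rw [setIntegral_closedBall_eq_rescale α _ i (by norm_num : (0 : ℝ) < 1 / 2),
      rescale_rescale α x i hr (by norm_num), ← hm]
    -- The factor `12` in `interiorBalls` is tuned for this: a centre displaced by `6r` with radius
    -- `r/2` uses `6r + 12(r/2) = 12r`.
    refine mul_le_mul_of_nonneg_left (le_csSup (bddAbove_masses hα hu hu0)
      ⟨(x + r • i, r * (1 / 2)), ⟨by positivity, ?_⟩, rfl⟩) hm0.le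
    have hi6 := mem_closedBall_zero_iff.1 (hI i hi)
    have : ‖x + r • i‖ ≤ ‖x‖ + r * ‖i‖ := by
      refine (norm_add_le _ _).trans ?_
      rw [norm_smul, Real.norm_of_nonneg hr.le]
    simp only
    nlinarith
  calc _ ≤ ∑ i ∈ I, m * massSup α u := h1.trans (Finset.sum_le_sum h2)
    _ = I.card * m * massSup α u := by rw [Finset.sum_const, nsmul_eq_mul]; ring
    _ ≤ _ := by nlinarith [massSup_nonneg α hu0]

/-- The coupled estimate holds on every interior ball by scaling; passing to suprema puts the mass
of `u` on both sides, and it is absorbed. -/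
lemma IsSupersolution.massSup_fst_le {n k : ℕ} (hk : 1 ≤ k) (hkn : (k : ℝ) < n / 2)
    {c p q α β : ℝ} (hc : 0 < c) (hp : 0 < p) (hα0 : 0 ≤ α) (hβ0 : 0 ≤ β)
    (hα : α + 2 * k = β * q) (hβ : β + 2 * k = α * p) :
    ∃ C : ℝ, 0 ≤ C ∧ ∀ u v : Euc n → ℝ, IsSupersolution k p q c u v →
      massSup α u ≤ C * massSup β v ^ (1 / p) := by
  obtain ⟨M₁, hM₁, h₁⟩ := exists_setIntegral_rescale_le_massSup n hα0
  obtain ⟨M₂, hM₂, h₂⟩ := exists_setIntegral_rescale_le_massSup n hβ0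
  -- This small parameter turns the enlarged-ball term into half of `massSup α u`.
  obtain ⟨C, hC, h⟩ := IsSupersolution.setIntegral_fst_le hk hkn hc hp
    (η := 1 / (2 * M₁)) (by positivity)
  refine ⟨2 * (C * M₂ ^ (1 / p)), by positivity, fun u v huv => ?_⟩
  have hu0 : ∀ x, 0 ≤ u x := fun x => (huv.pos_fst x).le
  have hv0 : ∀ x, 0 ≤ v x := fun x => (huv.pos_snd x).le
  have hkey : massSup α u ≤ 1 / (2 * M₁) * (M₁ * massSup α u) +
      C * (M₂ * massSup β v) ^ (1 / p) := by
    refine csSup_le (Nonempty.image _ ⟨(0, 1 / 12), by norm_num, by norm_num⟩) ?_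
    rintro _ ⟨z, hz, rfl⟩
    have hs := huv.rescale hα hβ z.1 hz.1
    refine (h q _ _ hs).trans ?_
    have e1 := h₁ u huv.contDiff_fst.continuous hu0 z hz
    have e2 := h₂ v huv.contDiff_snd.continuous hv0 z hz
    have e3 : 0 ≤ ∫ y in closedBall 0 6, _root_.rescale β z.1 z.2 v y :=
      integral_nonneg fun y => (hs.pos_snd y).le
    gcongr
  rw [Real.mul_rpow hM₂.le (massSup_nonneg β hv0)] at hkey
  have : 1 / (2 * M₁) * (M₁ * massSup α u) = massSup α u / 2 := by field_simp
  rw [this] at hkey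
  linarith

/-- Universal bound: supersolutions have uniformly bounded mass on the unit ball. -/
theorem IsSupersolution.exists_setIntegral_fst_bound {n k : ℕ} (hk : 1 ≤ k)
    (hkn : (k : ℝ) < n / 2) {c p q α β : ℝ} (hc : 0 < c) (hp : 0 < p) (hq : 0 < q)
    (hpq : 1 < p * q) (hα0 : 0 ≤ α) (hβ0 : 0 ≤ β)
    (hα : α + 2 * k = β * q) (hβ : β + 2 * k = α * p) :
    ∃ C : ℝ, 0 ≤ C ∧ ∀ u v : Euc n → ℝ, IsSupersolution k p q c u v →
      ∫ x in closedBall 0 1, u x ≤ C := by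
  obtain ⟨C₁, hC₁, h₁⟩ := IsSupersolution.massSup_fst_le hk hkn hc hp hα0 hβ0 hα hβ
  obtain ⟨C₂, hC₂, h₂⟩ := IsSupersolution.massSup_fst_le hk hkn hc hq hβ0 hα0 hβ hα
  refine ⟨(C₁ * C₂ ^ (1 / p)) ^ (1 / (1 - 1 / q * (1 / p))), by positivity, fun u v huv => ?_⟩
  -- Dilating by `12` makes the unit ball correspond to the interior ball of radius `1/12` about the
  -- origin.
  have hs := huv.rescale hα hβ 0 (r := 12) (by norm_num)
  set u' := _root_.rescale α 0 12 u with hu'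
  set v' := _root_.rescale β 0 12 v with hv'
  have hu0 : ∀ x, 0 ≤ u' x := fun x => (hs.pos_fst x).le
  have hv0 : ∀ x, 0 ≤ v' x := fun x => (hs.pos_snd x).le
  -- The two suprema bound each other with powers `1/p` and `1/q`; the composed power is below `1`
  -- because `pq > 1`, and the resulting bound no longer depends on `(u, v)`.
  have hmass : massSup α u' ≤ C₁ * C₂ ^ (1 / p) * massSup α u' ^ (1 / q * (1 / p)) := by
    refine (h₁ _ _ hs).trans ?_
    rw [mul_assoc, Real.rpow_mul (massSup_nonneg α hu0),
      ← Real.mul_rpow hC₂ (Real.rpow_nonneg (massSup_nonneg α hu0) _)]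
    have := massSup_nonneg β hv0
    gcongr
    exact h₂ _ _ hs.symm
  have hθ : 1 / q * (1 / p) < 1 := by
    rw [one_div_mul_one_div, div_lt_one (by positivity)]
    linarith
  refine le_trans ?_ (le_rpow_of_le_mul_rpow (massSup_nonneg α hu0) (by positivity) hθ hmass)
  refine le_csSup (bddAbove_masses hα0 hs.contDiff_fst.continuous hu0)
    ⟨(0, 1 / 12), ⟨by norm_num, by norm_num⟩, ?_⟩
  simp only [hu']
  rw [rescale_rescale α 0 0 (by norm_num) (by norm_num)]
  norm_num [rescale_zero_one]

lemma IsSupersolution.exists_setIntegral_fst_bound_closedBall {n k : ℕ} (hk : 1 ≤ k)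
    (hkn : (k : ℝ) < n / 2) {c p q α β : ℝ} (hc : 0 < c) (hp : 0 < p) (hq : 0 < q)
    (hpq : 1 < p * q) (hα0 : 0 ≤ α) (hβ0 : 0 ≤ β)
    (hα : α + 2 * k = β * q) (hβ : β + 2 * k = α * p) {ρ : ℝ} (hρ : 0 < ρ) :
    ∃ C : ℝ, 0 ≤ C ∧ ∀ u v : Euc n → ℝ, IsSupersolution k p q c u v →
      ∫ x in closedBall 0 ρ, u x ≤ C := by
  obtain ⟨C, hC, h⟩ := IsSupersolution.exists_setIntegral_fst_bound hk hkn hc hp hq hpq hα0 hβ0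
    hα hβ
  refine ⟨ρ ^ n * ρ ^ (-α) * C, by positivity, fun u v huv => ?_⟩
  rw [setIntegral_closedBall_eq_rescale α u 0 hρ]
  exact mul_le_mul_of_nonneg_left (h _ _ (huv.rescale hα hβ 0 hρ)) (by positivity)

/-! ### Propagation of smallness -/

/-- Bookkeeping for the next lemmas: with the universal bound `K`, these choices of error parameter
and threshold make each summand at most `η/2`. -/
lemma exists_add_mul_rpow_le {K C s η : ℝ} (hK : 0 ≤ K) (hC : 0 ≤ C) (hs : 0 < s) (hη : 0 < η) :
    (η / (2 * (K + 1))) * K + C * ((η / (2 * (C + 1))) ^ s) ^ (1 / s) ≤ η := by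
  rw [← Real.rpow_mul (by positivity), mul_one_div_cancel hs.ne', Real.rpow_one]
  have h : ∀ D : ℝ, 0 ≤ D → η / (2 * (D + 1)) * D ≤ η / 2 := fun D hD => by
    rw [div_mul_eq_mul_div, div_le_div_iff₀ (by positivity) (by norm_num)]
    nlinarith [mul_nonneg hη.le hD]
  have h1 := h K hK
  have h2 := h C hC
  linarith

lemma IsSupersolution.exists_small_fst_of_small_rpow {n k : ℕ} (hk : 1 ≤ k)
    (hkn : (k : ℝ) < n / 2) {c p q α β : ℝ} (hc : 0 < c) (hp : 0 < p) (hq : 0 < q)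
    (hpq : 1 < p * q) (hα0 : 0 ≤ α) (hβ0 : 0 ≤ β)
    (hα : α + 2 * k = β * q) (hβ : β + 2 * k = α * p) {η : ℝ} (hη : 0 < η) :
    ∃ δ : ℝ, 0 < δ ∧ ∀ u v : Euc n → ℝ, IsSupersolution k p q c u v →
      ∫ x in closedBall 0 1, u x ^ p ≤ δ → ∫ x in closedBall 0 1, u x ≤ η := by
  obtain ⟨K, hK, h₁⟩ := IsSupersolution.exists_setIntegral_fst_bound_closedBall hk hkn hc hp hq
    hpq hα0 hβ0 hα hβ (ρ := 6) (by norm_num)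
  obtain ⟨C, hC, h₂⟩ := setIntegral_le_add_rpow hk hkn (η := η / (2 * (K + 1))) (q := p)
    (by positivity) hp
  refine ⟨(η / (2 * (C + 1))) ^ p, by positivity, fun u v huv hδ => ?_⟩
  refine ((h₂ u huv.contDiff_fst huv.pos_fst (huv.negLaplacianPow_nonneg hc)).trans ?_).trans
    (exists_add_mul_rpow_le hK hC hp hη)
  have h3 := h₁ u v huv
  have h4 : 0 ≤ ∫ x in closedBall 0 1, u x ^ p :=
    integral_nonneg fun x => Real.rpow_nonneg (huv.pos_fst x).le _
  gcongr

lemma IsSupersolution.exists_small_fst_of_small_snd {n k : ℕ} (hk : 1 ≤ k)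
    (hkn : (k : ℝ) < n / 2) {c p q α β : ℝ} (hc : 0 < c) (hp : 0 < p) (hq : 0 < q)
    (hpq : 1 < p * q) (hα0 : 0 ≤ α) (hβ0 : 0 ≤ β)
    (hα : α + 2 * k = β * q) (hβ : β + 2 * k = α * p) {η : ℝ} (hη : 0 < η) :
    ∃ δ : ℝ, 0 < δ ∧ ∀ u v : Euc n → ℝ, IsSupersolution k p q c u v →
      ∫ x in closedBall 0 6, v x ≤ δ → ∫ x in closedBall 0 1, u x ≤ η := by
  obtain ⟨K, hK, h₁⟩ := IsSupersolution.exists_setIntegral_fst_bound_closedBall hk hkn hc hp hq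
    hpq hα0 hβ0 hα hβ (ρ := 6) (by norm_num)
  obtain ⟨C, hC, h₂⟩ := IsSupersolution.setIntegral_fst_le hk hkn (η := η / (2 * (K + 1))) (p := p)
    hc hp (by positivity)
  refine ⟨(η / (2 * (C + 1))) ^ p, by positivity, fun u v huv hδ => ?_⟩
  refine ((h₂ q u v huv).trans ?_).trans (exists_add_mul_rpow_le hK hC hp hη)
  have h3 := h₁ u v huv
  have h4 : 0 ≤ ∫ x in closedBall 0 6, v x := integral_nonneg fun x => (huv.pos_snd x).le
  gcongr

lemma rescale_rpow {n : ℕ} (β q : ℝ) (x : Euc n) {r : ℝ} (hr : 0 < r) {v : Euc n → ℝ}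
    (hv : ∀ x, 0 ≤ v x) (y : Euc n) :
    rescale (β * q) x r (fun z => v z ^ q) y = rescale β x r v y ^ q := by
  rw [rescale, rescale, Real.mul_rpow (Real.rpow_nonneg hr.le _) (hv _), ← Real.rpow_mul hr.le]

lemma setIntegral_rpow_closedBall_eq {n : ℕ} (β q : ℝ) (x : Euc n) {r : ℝ} (hr : 0 < r)
    {v : Euc n → ℝ} (hv : ∀ x, 0 ≤ v x) :
    ∫ y in closedBall x r, v y ^ q =
      r ^ n * r ^ (-(β * q)) * ∫ y in closedBall 0 1, rescale β x r v y ^ q := by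
  rw [setIntegral_closedBall_eq_rescale (β * q) (fun z => v z ^ q) x hr]
  simp only [rescale_rpow β q x hr hv]

/-- Reverse Hölder passes from `∫ v^q` to `∫ v`, after rescaling the ball of radius `6` to the unit
ball, and the coupled estimate passes from `∫ v` to `∫ u`. -/
lemma IsSupersolution.exists_small_fst_of_small_snd_rpow {n k : ℕ} (hk : 1 ≤ k)
    (hkn : (k : ℝ) < n / 2) {c p q α β : ℝ} (hc : 0 < c) (hp : 0 < p) (hq : 0 < q)
    (hpq : 1 < p * q) (hα0 : 0 ≤ α) (hβ0 : 0 ≤ β)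
    (hα : α + 2 * k = β * q) (hβ : β + 2 * k = α * p) {η : ℝ} (hη : 0 < η) :
    ∃ δ : ℝ, 0 < δ ∧ ∀ u v : Euc n → ℝ, IsSupersolution k p q c u v →
      ∫ x in closedBall 0 6, v x ^ q ≤ δ → ∫ x in closedBall 0 1, u x ≤ η := by
  have h6 : (0 : ℝ) < 6 := by norm_num
  obtain ⟨δ₁, hδ₁, h₁⟩ := IsSupersolution.exists_small_fst_of_small_snd hk hkn hc hp hq hpq
    hα0 hβ0 hα hβ hη
  obtain ⟨δ₂, hδ₂, h₂⟩ := IsSupersolution.exists_small_fst_of_small_rpow hk hkn hc hq hp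
    (by rwa [mul_comm]) hβ0 hα0 hβ hα (η := δ₁ / (6 ^ n * 6 ^ (-β))) (by positivity)
  refine ⟨6 ^ n * 6 ^ (-(β * q)) * δ₂, by positivity, fun u v huv hδ => h₁ u v huv ?_⟩
  have hs := huv.rescale hα hβ 0 h6
  rw [setIntegral_rpow_closedBall_eq β q 0 h6 (fun x => (huv.pos_snd x).le)] at hδ
  have h3 := h₂ _ _ hs.symm (le_of_mul_le_mul_left hδ (by positivity))
  rw [setIntegral_closedBall_eq_rescale β v 0 h6]
  rwa [le_div_iff₀' (by positivity)] at h3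

/-! ### Liouville theorem -/

/-- Liouville theorem: no positive supersolutions when the decay exponent reaches `n - 2k`. -/
theorem not_isSupersolution {n k : ℕ} (hk : 1 ≤ k) (hkn : (k : ℝ) < n / 2) {c p q : ℝ}
    (hc : 0 < c) (hp : 0 < p) (hq : 0 < q) (hpq : 1 < p * q)
    (hexp : (n : ℝ) - 2 * k ≤ 2 * k * (q + 1) / (p * q - 1)) (u v : Euc n → ℝ) :
    ¬ IsSupersolution k p q c u v := by
  intro huv
  have hd : 0 < p * q - 1 := by linarith
  obtain ⟨α, hαdef⟩ : ∃ α : ℝ, α = 2 * k * (q + 1) / (p * q - 1) := ⟨_, rfl⟩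
  obtain ⟨β, hβdef⟩ : ∃ β : ℝ, β = 2 * k * (p + 1) / (p * q - 1) := ⟨_, rfl⟩
  have hα0 : 0 ≤ α := by rw [hαdef]; positivity
  have hβ0 : 0 ≤ β := by rw [hβdef]; positivity
  have hα : α + 2 * k = β * q := by
    rw [hαdef, hβdef, div_mul_eq_mul_div, eq_div_iff hd.ne', add_mul, div_mul_cancel₀ _ hd.ne']
    ring
  have hβ : β + 2 * k = α * p := by
    rw [hαdef, hβdef, div_mul_eq_mul_div, eq_div_iff hd.ne', add_mul, div_mul_cancel₀ _ hd.ne']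
    ring
  rw [← hαdef] at hexp
  have hu0 : ∀ x, 0 ≤ u x := fun x => (huv.pos_fst x).le
  have hv0 : ∀ x, 0 ≤ v x := fun x => (huv.pos_snd x).le
  have hf0 : ∀ x, 0 < v x ^ q := fun x => Real.rpow_pos_of_pos (huv.pos_snd x) q
  have hfc : Continuous fun x => v x ^ q :=
    huv.contDiff_snd.continuous.rpow_const fun x => Or.inl (huv.pos_snd x).ne'
  have hQpos : 0 < ∫ x in closedBall 0 1, v x ^ q := by
    rw [setIntegral_pos_iff_support_of_nonneg_ae (ae_of_all _ fun x => (hf0 x).le)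
      (hfc.integrableOn_closedBall 0 1)]
    have : Function.support (fun x => v x ^ q) = univ := eq_univ_of_forall fun x => (hf0 x).ne'
    rw [this, univ_inter]
    exact measure_closedBall_pos _ _ one_pos
  have hmono : ∀ R : ℝ, 1 ≤ R → ∫ x in closedBall 0 1, v x ^ q ≤ ∫ x in closedBall 0 R, v x ^ q :=
    fun R hR => setIntegral_mono_closedBall hfc (fun x => (hf0 x).le)
      (closedBall_subset_closedBall hR)
  obtain ⟨C, hC, hcut⟩ := IsSupersolution.setIntegral_rpow_le n hk hc
  have hJ : ∀ R : ℝ, 0 < R → ∫ x in closedBall 0 R, v x ^ q ≤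
      R ^ n * R ^ (-(β * q)) *
        (C * ∫ x in closedBall 0 2 \ ball 0 1, rescale α 0 R u x) := fun R hR => by
    rw [setIntegral_rpow_closedBall_eq β q 0 hR hv0]
    exact mul_le_mul_of_nonneg_left (hcut q p _ _ (huv.rescale hα hβ 0 hR).symm) (by positivity)
  obtain ⟨K, hK, hbound⟩ := IsSupersolution.exists_setIntegral_fst_bound_closedBall hk hkn hc hp hq
    hpq hα0 hβ0 hα hβ (ρ := 2) (by norm_num)
  have hJ' : ∀ R : ℝ, 0 < R → ∫ x in closedBall 0 R, v x ^ q ≤ R ^ (n - β * q) * (C * K) :=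
    fun R hR => by
      have hs := huv.rescale hα hβ 0 hR
      refine (hJ R hR).trans ?_
      rw [← Real.rpow_natCast R n, ← Real.rpow_add hR, ← sub_eq_add_neg]
      refine mul_le_mul_of_nonneg_left (mul_le_mul_of_nonneg_left ?_ hC) (by positivity)
      exact (setIntegral_mono_closedBall hs.contDiff_fst.continuous (fun x => (hs.pos_fst x).le)
        sdiff_subset).trans (hbound _ _ hs)
  have hγ : (n : ℝ) - β * q ≤ 0 := by linarith
  rcases hγ.lt_or_eq with hlt | heq
  · have hlim : Tendsto (fun R : ℝ => R ^ ((n : ℝ) - β * q) * (C * K)) atTop (𝓝 (0 * (C * K))) := by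
      have := tendsto_rpow_neg_atTop (y := -((n : ℝ) - β * q)) (by linarith)
      rw [neg_neg] at this
      exact this.mul_const _
    rw [zero_mul] at hlim
    obtain ⟨R, hR1, hR2⟩ := ((hlim.eventually (gt_mem_nhds hQpos)).and
      (eventually_ge_atTop 1)).exists
    exact absurd ((hmono R hR2).trans (hJ' R (by linarith))) (not_le.2 hR1)
  -- Critical case `βq = n`: the bound no longer decays, but it gives integrability, and `∫ v^q` is
  -- scale invariant.
  · have hint : Integrable fun x => v x ^ q := by
      refine (aecover_closedBall (μ := volume) (x := (0 : Euc n))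
        (tendsto_natCast_atTop_atTop (R := ℝ))).integrable_of_integral_bounded_of_nonneg_ae (C * K)
        (fun i => hfc.integrableOn_closedBall 0 i) (ae_of_all _ fun x => (hf0 x).le) ?_
      filter_upwards [eventually_gt_atTop 0] with i hi
      have := hJ' i (by exact_mod_cast hi)
      rwa [heq, Real.rpow_zero, one_mul] at this
    have htail : Tendsto (fun i : ℕ => ∫ x in (ball (0 : Euc n) i)ᶜ, v x ^ q) atTop (𝓝 0) := by
      have := tendsto_setIntegral_of_antitone (μ := volume) (f := fun x => v x ^ q)
        (s := fun i : ℕ => (ball (0 : Euc n) i)ᶜ) (fun i => measurableSet_ball.compl)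
        (fun i j hij => compl_subset_compl.2 (ball_subset_ball (by exact_mod_cast hij)))
        ⟨0, hint.integrableOn⟩
      have he : ⋂ i : ℕ, (ball (0 : Euc n) i)ᶜ = ∅ := by
        refine eq_empty_of_forall_notMem fun x hx => ?_
        obtain ⟨i, hi⟩ := exists_nat_gt ‖x‖
        exact mem_iInter.1 hx i (mem_ball_zero_iff.2 hi)
      rwa [he, setIntegral_empty] at this
    have hρ : (0 : ℝ) < 1 / 12 := by norm_num
    obtain ⟨I, hI, hcov⟩ := exists_cover_setIntegral_le
      ((isCompact_closedBall (0 : Euc n) 2).diff isOpen_ball : IsCompact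
        (closedBall (0 : Euc n) 2 \ ball 0 1)) hρ
    set m : ℝ := (1 / 12) ^ n * (1 / 12) ^ (-α) with hm
    have hm0 : 0 < m := by positivity
    set η : ℝ := (∫ x in closedBall 0 1, v x ^ q) / (2 * (C * (I.card * m) + 1)) with hη
    have hη0 : 0 < η := by positivity
    obtain ⟨δ, hδ, hsmall⟩ := IsSupersolution.exists_small_fst_of_small_snd_rpow hk hkn hc hp hq
      hpq hα0 hβ0 hα hβ hη0
    obtain ⟨i, hi1, hi2⟩ := ((htail.eventually (gt_mem_nhds hδ)).and
      (eventually_ge_atTop 1)).exists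
    have hi : (1 : ℝ) ≤ i := by exact_mod_cast hi2
    -- A ball of radius `1/12` about `z` in the annulus, scaled by `R` and enlarged six times, has
    -- radius `R/2`; as `|Rz| ≥ R`, it lies outside the ball of radius `R/2 = i`, where the integral
    -- of `v^q` is below `δ`.
    obtain ⟨R, hRdef⟩ : ∃ R : ℝ, R = 2 * i := ⟨_, rfl⟩
    have hR : 0 < R := by linarith
    have hs := huv.rescale hα hβ 0 hR
    have hann : ∫ x in closedBall 0 2 \ ball 0 1, rescale α 0 R u x ≤ I.card * (m * η) := by
      refine (hcov _ hs.contDiff_fst.continuous fun x => (hs.pos_fst x).le).trans ?_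
      rw [← nsmul_eq_mul, ← Finset.sum_const]
      refine Finset.sum_le_sum fun z hz => ?_
      rw [setIntegral_closedBall_eq_rescale α _ z hρ, rescale_rescale α 0 z hR hρ, ← hm]
      refine mul_le_mul_of_nonneg_left ?_ hm0.le
      have hRρ : 0 < R * (1 / 12) := by positivity
      refine hsmall _ _ (huv.rescale hα hβ _ hRρ) ?_
      have hz1 : 1 ≤ ‖z‖ := by simpa using (hI z hz).2
      have e1 := setIntegral_closedBall_comp_affine (fun y => v y ^ q) (0 + R • z) 0 hRρ 6
      have e2 : ∀ y, rescale β (0 + R • z) (R * (1 / 12)) v y ^ q =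
          (R * (1 / 12)) ^ (β * q) * v (0 + R • z + (R * (1 / 12)) • y) ^ q := fun y =>
        (rescale_rpow β q _ hRρ hv0 y).symm
      simp only [e2]
      rw [integral_const_mul, e1, show β * q = n by linarith, Real.rpow_natCast,
        mul_inv_cancel_left₀ (by positivity)]
      refine le_trans ?_ hi1.le
      refine setIntegral_mono_set hint.integrableOn (ae_of_all _ fun x => (hf0 x).le)
        (LE.le.eventuallyLE fun y hy => ?_)
      rw [smul_zero, add_zero, zero_add, mem_closedBall, dist_eq_norm] at hy
      rw [mem_compl_iff, mem_ball_zero_iff, not_lt]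
      have h1 : ‖R • z‖ = R * ‖z‖ := by rw [norm_smul, Real.norm_of_nonneg hR.le]
      have h2 : ‖R • z‖ ≤ ‖y‖ + ‖y - R • z‖ := by
        rw [norm_sub_rev]
        exact norm_le_insert' _ _
      nlinarith
    have h1 := (hmono R (by linarith)).trans (hJ R hR)
    have h2 : R ^ n * R ^ (-(β * q)) = 1 := by
      rw [← Real.rpow_natCast R n, ← Real.rpow_add hR, ← sub_eq_add_neg, heq, Real.rpow_zero]
    rw [h2, one_mul] at h1
    have h3 := h1.trans (mul_le_mul_of_nonneg_left hann hC)
    have h4 : C * (I.card * (m * η)) < ∫ x in closedBall 0 1, v x ^ q := by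
      have h5 : η * (2 * (C * (I.card * m) + 1)) = ∫ x in closedBall 0 1, v x ^ q := by
        rw [hη, div_mul_cancel₀ _ (by positivity)]
      rw [← h5]
      have : 0 ≤ C * (I.card * m) * η := by positivity
      nlinarith
    linarith

/-! ### From solutions to the exponent condition -/

lemma IsPositiveSystemSolution.exists_isSupersolution {n k : ℕ} {p q : ℝ}
    {c₁ c₂ u v : Euc n → ℝ} (h₁ : DoubleBounded c₁) (h₂ : DoubleBounded c₂)
    (h : IsPositiveSystemSolution k p q c₁ c₂ u v) : ∃ c, 0 < c ∧ IsSupersolution k p q c u v := by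
  obtain ⟨C₁, hC₁, hc₁⟩ := h₁
  obtain ⟨C₂, hC₂, hc₂⟩ := h₂
  refine ⟨min (1 / C₁) (1 / C₂), by positivity, h.contDiff_fst, h.contDiff_snd, h.pos_fst,
    h.pos_snd, fun x => ?_, fun x => ?_⟩
  · rw [h.eq_fst]
    exact mul_le_mul_of_nonneg_right ((min_le_left _ _).trans (hc₁ x).1)
      (Real.rpow_nonneg (h.pos_snd x).le _)
  · rw [h.eq_snd]
    exact mul_le_mul_of_nonneg_right ((min_le_right _ _).trans (hc₂ x).1)
      (Real.rpow_nonneg (h.pos_fst x).le _)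

/-- The exponent condition is necessary for solvability of the system. -/
theorem IsPositiveSystemSolution.exponents_lt {n k : ℕ} (hk : 1 ≤ k) (hkn : (k : ℝ) < n / 2)
    {p q : ℝ} (hp : 0 < p) (hq : 0 < q) (hpq : 1 < p * q) {c₁ c₂ u v : Euc n → ℝ}
    (h₁ : DoubleBounded c₁) (h₂ : DoubleBounded c₂)
    (h : IsPositiveSystemSolution k p q c₁ c₂ u v) :
    max (2 * (k : ℝ) * (p + 1) / (p * q - 1)) (2 * (k : ℝ) * (q + 1) / (p * q - 1))
      < (n : ℝ) - 2 * (k : ℝ) := by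
  obtain ⟨c, hc, hs⟩ := h.exists_isSupersolution h₁ h₂
  refine max_lt ?_ ?_
  -- The other exponent is handled by exchanging `u` with `v` and `p` with `q`.
  · by_contra hlt
    refine not_isSupersolution hk hkn hc hq hp (by rwa [mul_comm]) ?_ v u hs.symm
    rw [mul_comm q p]
    exact not_lt.1 hlt
  · by_contra hlt
    exact not_isSupersolution hk hkn hc hp hq hpq (not_lt.1 hlt) u v hs

theorem corollary1p6 (n k : ℕ) (hk : 1 ≤ k) (hkn : (k : ℝ) < (n : ℝ) / 2) :
    (∀ p : ℝ, 1 < p →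
      ((∃ c u : EuclideanSpace ℝ (Fin n) → ℝ, DoubleBounded c ∧ IsPositiveSolution k p c u) ↔
        (n : ℝ) / ((n : ℝ) - 2 * (k : ℝ)) < p)) ∧
    (∀ p q : ℝ, 0 < p → 0 < q → 1 < p * q →
      ((∃ c₁ c₂ u v : EuclideanSpace ℝ (Fin n) → ℝ,
          DoubleBounded c₁ ∧ DoubleBounded c₂ ∧ IsPositiveSystemSolution k p q c₁ c₂ u v) ↔
        max (2 * (k : ℝ) * (p + 1) / (p * q - 1)) (2 * (k : ℝ) * (q + 1) / (p * q - 1))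
          < (n : ℝ) - 2 * (k : ℝ))) := by
  refine ⟨fun p hp => ⟨?_, exists_scalar_solution hk hkn hp⟩, fun p q hp hq hpq =>
    ⟨?_, exists_system_solution hk hp hq hpq⟩⟩
  · rintro ⟨c, u, hc, h⟩
    -- The diagonal system has exponent `2k(p+1)/(p²-1) = 2k/(p-1)`, and `2k/(p-1) < n - 2k`
    -- rearranges to `p > n/(n-2k)`.
    have hsys : IsPositiveSystemSolution k p p c c u u :=
      ⟨h.contDiff, h.contDiff, h.pos, h.pos, h.eq, h.eq⟩
    have h1 := hsys.exponents_lt hk hkn (by linarith) (by linarith) (by nlinarith) hc hc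
    rw [max_self, div_lt_iff₀ (by nlinarith)] at h1
    rw [div_lt_iff₀ (by linarith)]
    nlinarith
  · rintro ⟨c₁, c₂, u, v, h₁, h₂, h⟩
    exact h.exponents_lt hk hkn hp hq hpq h₁ h₂
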